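/- Let $\Sigma$ be a finite linearly ordered alphabet. Words over $\Sigma$ are ordered by radix order: $u<v$ if $|u|<|v|$, or if $|u|=|v|$ and $u$ precedes $v$ lexicographically. For $L\subseteq\Sigma^*$ and $u,v\in\Sigma^*$, the word $v$ is the $L$-successor of $u$ if $u<v$, $v\in L$, and no word $w$ with $u<w<v$ belongs to $L$ (a word may have no $L$-successor). A finite-state transducer over $\Sigma$ consists of a finite set $Q$ of states, an initial state, a set of accepting states, and a transition function $Q\times(\Sigma\cup\{\varepsilon\})\to 2^{Q\times(\Sigma\cup\{\varepsilon\})}$; each transition reads a letter or the empty word and writes a letter or the empty word. It maps $u$ to $v$ if some accepting run (a sequence of consecutive transitions from the initial state to an accepting state) reads $u$ and writes $v$. It is unambiguous if every input word has at most one accepting run. DFAs are complete, and not necessarily minimal. Then $2^{\Theta(\sqrt{n\log n})}$ states are, in general, necessary and sufficient for an unambiguous finite-state transducer that maps words to their $L$-successors, where $L$ is given by an $n$-state DFA. That is, there are absolute constants $c,C>0$ such that for every integer $n\ge 2$: 1. (Sufficient.) For every finite linearly ordered alphabet $\Sigma$ and every DFA $\mathcal A$ over $\Sigma$ with $n$ states,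 there is an unambiguous finite-state transducer with at most $2^{C\sqrt{n\log n}}$ states which, for all $u,v\in\Sigma^*$, maps $u$ to $v$ if and only if $v$ is the $L(\mathcal A)$-successor of $u$. (In particular, it rejects the words that have no $L(\mathcal A)$-successor.) 2. (Necessary.) There are a finite linearly ordered alphabet $\Sigma$ and a DFA $\mathcal A$ over $\Sigma$ with $n$ states such that every unambiguous finite-state transducer that maps each word having an $L(\mathcal A)$-successor to that successor has at least $2^{c\sqrt{n\log n}}$ states. -/

import Mathlib

/-- `v` is the `L`-successor of `u`: the smallest word of `L` that is strictly larger than `u`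
in the radix (length-lexicographic) order. -/
def IsSuccessor {α : Type*} [LinearOrder α] (L : Language α) (u v : List α) : Prop :=
  List.Shortlex (· < ·) u v ∧ v ∈ L ∧
    ∀ w : List α, List.Shortlex (· < ·) u w → List.Shortlex (· < ·) w v → w ∉ L

/-- A (nondeterministic) finite-state transducer with input alphabet `α`, output alphabet `β` and
set of states `σ`; finiteness is imposed where it is used. The letter `none` is the empty word:
`(q, b) ∈ step p a` is the transition from `p` to `q` that reads `a` and writes `b`. -/
structure Transducer (α β σ : Type*) where
  step : σ → Option α → Set (σ × Option β)
  start : σ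
  accept : Set σ

namespace Transducer

variable {α β σ : Type*}

/-- `T.IsPath p r q`: the list `r` of triples (letter read, letter written, next state) is a
sequence of consecutive transitions leading from `p` to `q`. -/
inductive IsPath (T : Transducer α β σ) : σ → List (Option α × Option β × σ) → σ → Prop
  | nil (p : σ) : IsPath T p [] p
  | cons {p q s : σ} {a : Option α} {b : Option β} {r : List (Option α × Option β × σ)} :
      (q, b) ∈ T.step p a → IsPath T q r s → IsPath T p ((a, b, q) :: r) s

/-- The input word of a sequence of transitions. -/
def inputWord (r : List (Option α × Option β × σ)) : List α :=
  r.filterMap fun t => t.1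

/-- The output word of a sequence of transitions. -/
def outputWord (r : List (Option α × Option β × σ)) : List β :=
  r.filterMap fun t => t.2.1

/-- `r` is an accepting run of `T` on the input `u`. -/
def IsAcceptingRun (T : Transducer α β σ) (u : List α) (r : List (Option α × Option β × σ)) :
    Prop :=
  inputWord r = u ∧ ∃ q ∈ T.accept, T.IsPath T.start r q

/-- `T` is unambiguous: every input has at most one accepting run. -/
def Unambiguous (T : Transducer α β σ) : Prop :=
  ∀ (u : List α) (r r' : List (Option α × Option β × σ)),
    T.IsAcceptingRun u r → T.IsAcceptingRun u r' → r = r'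

/-- `T` maps the word `u` to the word `v`: some accepting run on `u` outputs `v`. -/
def Maps (T : Transducer α β σ) (u : List α) (v : List β) : Prop :=
  ∃ r, T.IsAcceptingRun u r ∧ outputWord r = v

end Transducer

/-! Upper bound. The transducer writes the successor letter by letter while guessing which states of
`A` accept a word of the remaining output length `k`, that is, the set `A.live k`. With this set
known, the least admissible letters are determined locally. The guess is checked backwards: the set
before a letter must be `A.pred` of the set after it, and the last one must be `A.accept`. An
accepting run therefore guesses correctly, and this makes the transducer unambiguous. Either the
output copies the input up to the last position where a larger letter is possible, or no larger word
of the same length is accepted and the output is the least accepted word of the next possible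
length, whose surplus letters are written before any input is read.

The number of states is polynomial in `n` times the number of distinct sets `A.live k`. A maximal
disjoint union of cycles in the graph of `A` meets every walk with at least `n` steps, so such a
walk can be prolonged by the order `P` of the permutation that rotates these cycles. Thus `A.live k
⊆ A.live (k + P)` for `k ≥ n`, and each residue class mod `P` contributes a chain of at most `n + 1`
sets. Landau's bound gives `log P = O(√(n log n))`.

Lower bound. Take cycles of pairwise coprime lengths `q i`, the largest powers at most `x` of the
primes up to `x`. In `cycleDFA` the successor of `⊥ ^ (k + 1)` begins with `⊤` exactly if no `q i`
divides `k`. Cutting the unique accepting run at a letter factors the 0-1 matrix of this property,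
with `k` split as a sum, through pairs of a state and a bit telling whether output has begun. By the
Chinese remainder theorem the matrix contains a Kronecker product of invertible matrices of sizes `q
i`, so twice the number of states is at least `∏ q i = lcm(1, ..., x)`. Chebyshev's estimates allow
`x` of order `√(n log n)`. -/

/-! ### Long walks in finite digraphs and periodicity of their lengths. -/

section Walks

variable {V : Type*}

/-- `IsWalk G k x y`: there is a walk with `k` steps from `x` to `y` in the digraph `G`. -/
def IsWalk (G : V → V → Prop) : ℕ → V → V → Prop
  | 0, x, y => x = y
  | k + 1, x, y => ∃ z, G x z ∧ IsWalk G k z y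

theorem IsWalk.trans {G : V → V → Prop} {k l : ℕ} {x y z : V} (h : IsWalk G k x y)
    (h' : IsWalk G l y z) : IsWalk G (k + l) x z := by
  induction k generalizing x with
  | zero => cases h; simpa using h'
  | succ k ih =>
    obtain ⟨w, hw, h⟩ := h
    rw [Nat.add_right_comm]
    exact ⟨w, hw, ih h⟩

/-- A walk visits the set `W` or stays in its complement. -/
theorem IsWalk.visits_or_avoids {G : V → V → Prop} (W : Set V) {k : ℕ} {x y : V}
    (h : IsWalk G k x y) :
    (∃ i j, i + j = k ∧ ∃ z ∈ W, IsWalk G i x z ∧ IsWalk G j z y) ∨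
      IsWalk (fun a b => G a b ∧ a ∉ W ∧ b ∉ W) k x y := by
  induction k generalizing x with
  | zero => exact Or.inr h
  | succ k ih =>
    by_cases hx : x ∈ W
    · exact Or.inl ⟨0, k + 1, by simp, x, hx, rfl, h⟩
    obtain ⟨z, hz, h⟩ := h
    by_cases hzW : z ∈ W
    · exact Or.inl ⟨1, k, by omega, z, hzW, ⟨z, hz, rfl⟩, h⟩
    obtain ⟨i, j, hij, w, hw, h1, h2⟩ | h' := ih h
    · exact Or.inl ⟨i + 1, j, by omega, w, hw, ⟨z, hz, h1⟩, h2⟩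
    · exact Or.inr ⟨z, ⟨hz, hx, hzW⟩, h'⟩

/-- In a finite digraph in which no nonempty set is closed under the choice of some successor,
all walks are shorter than the number of vertices. -/
theorem IsWalk.lt_card [Fintype V] {G : V → V → Prop}
    (hG : ∀ X : Set V, (∀ x ∈ X, ∃ y ∈ X, G x y) → X = ∅) {k : ℕ} {x y : V}
    (h : IsWalk G k x y) : k < Fintype.card V := by
  set D : ℕ → Set V := fun k => {x | ∃ y, IsWalk G k x y} with hD
  have hsub : ∀ k, D (k + 1) ⊆ D k := by
    intro k
    induction k with
    | zero => exact fun x _ => ⟨x, rfl⟩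
    | succ k ih =>
      rintro x ⟨y, z, hz, h⟩
      obtain ⟨w, hw⟩ := ih ⟨y, h⟩
      exact ⟨w, z, hz, hw⟩
  -- While `D` shrinks it loses a vertex per step; once it is stationary it is closed under the
  -- choice of a successor, hence empty.
  have hcard : ∀ k, (D k).ncard ≤ Fintype.card V - k := by
    intro k
    induction k with
    | zero => simpa [Nat.card_eq_fintype_card] using Set.ncard_le_card (D 0)
    | succ k ih =>
      by_cases he : D (k + 1) = D k
      · have : D k = ∅ := by
          apply hG
          intro x hx
          rw [← he] at hx
          obtain ⟨y, z, hz, h⟩ := hx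
          exact ⟨z, ⟨y, h⟩, hz⟩
        rw [he, this]; simp
      · have := Set.ncard_lt_ncard ((hsub k).ssubset_of_ne he)
        omega
  by_contra! hk
  have h0 : D k = ∅ := by
    have := hcard k
    rw [Nat.sub_eq_zero_of_le hk, Nat.le_zero, Set.ncard_eq_zero] at this
    exact this
  exact (h0 ▸ (⟨y, h⟩ : x ∈ D k) : x ∈ (∅ : Set V))

/-- `W` is a disjoint union of cycles of the digraph `G`. -/
def IsCycleUnion (G : V → V → Prop) (W : Set V) : Prop :=
  ∃ h : V → V, Set.MapsTo h W W ∧ Set.InjOn h W ∧ ∀ x ∈ W, G x (h x)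

/-- A nonempty set closed under the choice of some successor contains a cycle. -/
theorem exists_isCycleUnion_subset [Finite V] {G : V → V → Prop} {X : Set V} (hX : X.Nonempty)
    (h : ∀ x ∈ X, ∃ y ∈ X, G x y) : ∃ Y ⊆ X, Y.Nonempty ∧ IsCycleUnion G Y := by
  classical
  choose! g hgX hg using h
  have hmaps : Set.MapsTo g X X := hgX
  obtain ⟨x, hx⟩ := hX
  -- A self-map permutes its periodic points, and finiteness makes every orbit reach one.
  refine ⟨X ∩ Function.periodicPts g, Set.inter_subset_left, ?_, g, ?_, ?_,
    fun x hx => hg x hx.1⟩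
  · obtain ⟨m, n, hmn, he⟩ := Finite.exists_ne_map_eq_of_infinite (fun k : ℕ => g^[k] x)
    wlog hlt : m < n generalizing m n
    · exact this n m hmn.symm he.symm (by omega)
    refine ⟨g^[m] x, hmaps.iterate m hx, Function.mk_mem_periodicPts (n := n - m) (by omega) ?_⟩
    change g^[n - m] (g^[m] x) = g^[m] x
    rw [← Function.iterate_add_apply, Nat.sub_add_cancel hlt.le]
    exact he.symm
  · exact hmaps.inter_inter (Function.bijOn_periodicPts g).mapsTo
  · exact (Function.bijOn_periodicPts g).injOn.mono Set.inter_subset_right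

theorem IsCycleUnion.union {G : V → V → Prop} {W Y : Set V} (hW : IsCycleUnion G W)
    (hY : IsCycleUnion G Y) (hd : Disjoint W Y) : IsCycleUnion G (W ∪ Y) := by
  classical
  obtain ⟨h, hm, hi, hG⟩ := hW
  obtain ⟨g, gm, gi, gG⟩ := hY
  have e1 : Set.EqOn (W.piecewise h g) h W := Set.piecewise_eqOn _ _ _
  have e2 : Set.EqOn (W.piecewise h g) g Y :=
    (Set.piecewise_eqOn_compl W h g).mono (Set.disjoint_left.1 hd.symm)
  refine ⟨W.piecewise h g, ?_, ?_, ?_⟩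
  · exact (hm.congr e1.symm).union_union (gm.congr e2.symm)
  · rw [Set.injOn_union hd]
    refine ⟨hi.congr e1.symm, gi.congr e2.symm, fun x hx y hy => ?_⟩
    rw [e1 hx, e2 hy]
    exact hd.ne_of_mem (hm hx) (gm hy)
  · rintro x (hx | hx)
    · rw [e1 hx]; exact hG x hx
    · rw [e2 hx]; exact gG x hx

/-- There is a disjoint union of cycles that every long walk meets. -/
theorem exists_isCycleUnion_forall_isWalk [Fintype V] (G : V → V → Prop) :
    ∃ W : Set V, IsCycleUnion G W ∧ ∀ k x y, Fintype.card V ≤ k → IsWalk G k x y →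
      ∃ i j, i + j = k ∧ ∃ z ∈ W, IsWalk G i x z ∧ IsWalk G j z y := by
  obtain ⟨W, hW⟩ := Set.Finite.exists_maximal (Set.toFinite {W : Set V | IsCycleUnion G W})
    ⟨∅, id, by simp [Set.MapsTo], by simp, by simp⟩
  refine ⟨W, hW.prop, fun k x y hk h => (h.visits_or_avoids W).resolve_right fun h' => ?_⟩
  -- A long walk outside `W` would yield a cycle disjoint from `W`, against maximality.
  refine absurd (h'.lt_card fun X hX => ?_) (by omega)
  by_contra hne
  obtain ⟨Y, hYX, hY, h⟩ := exists_isCycleUnion_subset (Set.nonempty_iff_ne_empty.2 hne) hX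
  have hd : Disjoint W Y := Set.disjoint_right.2 fun y hy => by
    obtain ⟨_, _, _, h, _⟩ := hX y (hYX hy)
    exact h
  obtain ⟨z, -, -, hzW, -⟩ := hX _ (hYX hY.some_mem)
  obtain ⟨g, gm, gi, gG⟩ := h
  have hYG : IsCycleUnion G Y := ⟨g, gm, gi, fun x hx => (gG x hx).1⟩
  have hle := hW.le_of_ge (hW.prop.union hYG hd) Set.subset_union_left
  exact Set.disjoint_left.1 hd (hle (Or.inr hY.some_mem)) hY.some_mem

/-- There is a permutation whose order is a period of the possible lengths of long walks. -/
theorem exists_perm_forall_isWalk_add_orderOf [Fintype V] (G : V → V → Prop) :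
    ∃ f : Equiv.Perm V, ∀ k x y, Fintype.card V ≤ k → IsWalk G k x y →
      IsWalk G (k + orderOf f) x y := by
  classical
  obtain ⟨W, ⟨h, hm, hi, hG⟩, hW⟩ := exists_isCycleUnion_forall_isWalk G
  have hinj : Function.Injective (W.piecewise h id) := by
    refine (Set.injective_piecewise_iff _).2 ⟨hi, Set.injOn_id _, fun x hx y hy => ?_⟩
    rintro rfl
    exact hy (hm hx)
  let f : Equiv.Perm V := Equiv.ofBijective _ (Finite.injective_iff_bijective.1 hinj)
  have hf : ∀ x ∈ W, f x = h x := fun x hx => Set.piecewise_eq_of_mem _ _ _ hx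
  have hmul : ∀ m, ∀ x ∈ W, IsWalk G m x ((f ^ m) x) := by
    intro m
    induction m with
    | zero => exact fun x _ => rfl
    | succ m ih =>
      intro x hx
      refine ⟨h x, hG x hx, ?_⟩
      rw [pow_succ, Equiv.Perm.mul_apply, hf x hx]
      exact ih _ (hm hx)
  refine ⟨f, fun k x y hk hw => ?_⟩
  obtain ⟨i, j, rfl, z, hz, h1, h2⟩ := hW k x y hk hw
  have h3 := hmul (orderOf f) z hz
  rw [pow_orderOf_eq_one, Equiv.Perm.one_apply] at h3
  have := h1.trans (h3.trans h2)
  rwa [add_left_comm, add_comm] at this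

/-- A sequence of subsets of an `n`-element set that grows with period `P` from index `n` on has
few terms. -/
theorem ncard_range_le_of_subset_add [Fintype V] (S : ℕ → Set V) {P : ℕ} (hP : 0 < P)
    (hS : ∀ k, Fintype.card V ≤ k → S k ⊆ S (k + P)) :
    (Set.range S).ncard ≤ Fintype.card V + P * (Fintype.card V + 1) := by
  set n := Fintype.card V with hn
  have hmono : ∀ k m, n ≤ k → S k ⊆ S (k + P * m) := by
    intro k m hk
    induction m with
    | zero => simp
    | succ m ih => exact ih.trans (by rw [Nat.mul_succ, ← add_assoc]; exact hS _ (by omega))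
  have hcard : ∀ k, (S k).ncard < n + 1 := fun k => by
    have := Set.ncard_le_card (S k)
    rw [Nat.card_eq_fintype_card] at this
    omega
  -- Sets whose indices agree mod `P` are nested, so the residue and the cardinality determine the
  -- set.
  have hle : (S '' Set.Ici n).ncard ≤ P * (n + 1) := by
    have hc : (Finset.range P ×ˢ Finset.range (n + 1)).card = P * (n + 1) := by simp
    rw [← hc, ← Set.ncard_coe_finset]
    choose! ix hix hS' using fun (s : Set V) (hs : s ∈ S '' Set.Ici n) => hs
    refine Set.ncard_le_ncard_of_injOn (fun s => (ix s % P, s.ncard)) ?_ ?_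
    · intro s hs
      have := hcard (ix s)
      rw [hS' s hs] at this
      simpa [Nat.lt_succ_iff] using ⟨Nat.mod_lt _ hP, Nat.lt_succ_iff.1 this⟩
    · intro s hs t ht hst
      simp only [Prod.mk.injEq] at hst
      wlog hlt : ix s ≤ ix t generalizing s t
      · exact (this ht hs ⟨hst.1.symm, hst.2.symm⟩ (by omega)).symm
      obtain ⟨m, hm⟩ := (Nat.modEq_iff_dvd' hlt).1 hst.1
      refine Set.eq_of_subset_of_ncard_le ?_ hst.2.ge (Set.toFinite _)
      have := hmono (ix s) m (hix s hs)
      rwa [← hm, Nat.add_sub_cancel' hlt, hS' s hs, hS' t ht] at this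
  have hun : Set.range S = S '' Set.Iio n ∪ S '' Set.Ici n := by
    rw [← Set.image_union, Set.Iio_union_Ici, Set.image_univ]
  rw [hun]
  refine (Set.ncard_union_le _ _).trans (add_le_add ?_ hle)
  refine (Set.ncard_image_le (Set.finite_Iio n)).trans ?_
  simp [Set.ncard_eq_toFinset_card']

end Walks

/-! ### Bounds for the orders of permutations and for sums of prime powers. -/

section Landau

theorem Finset.sum_le_prod_of_two_le {s : Finset ℕ} (h : ∀ p ∈ s, 2 ≤ p) :
    ∑ p ∈ s, p ≤ ∏ p ∈ s, p := by
  induction s using Finset.induction_on with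
  | empty => simp
  | insert a s ha ih =>
    rw [Finset.sum_insert ha, Finset.prod_insert ha]
    have h2 := h a (Finset.mem_insert_self a s)
    have ih := ih fun p hp => h p (Finset.mem_insert_of_mem hp)
    rcases s.eq_empty_or_nonempty with rfl | ⟨b, hb⟩
    · simp
    have h3 : 2 ≤ ∑ p ∈ s, p :=
      (h b (Finset.mem_insert_of_mem hb)).trans
        (Finset.single_le_sum (f := fun p : ℕ => p) (fun _ _ => Nat.zero_le _) hb)
    nlinarith

/-- Every prime factor of the lcm divides some member, and the distinct primes dividing `a` have a
sum at most their product, hence at most `a`. -/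
theorem Multiset.sum_primeFactors_lcm_le {s : Multiset ℕ} (h : 0 ∉ s) :
    ∑ p ∈ s.lcm.primeFactors, p ≤ s.sum := by
  induction s using Multiset.induction_on with
  | empty => simp
  | cons a s ih =>
    simp only [Multiset.mem_cons, not_or] at h
    have ha : a ≠ 0 := fun h0 => h.1 h0.symm
    have hs : s.lcm ≠ 0 := by rw [Ne, Multiset.lcm_eq_zero_iff]; exact h.2
    rw [Multiset.lcm_cons, Multiset.sum_cons]
    change ∑ p ∈ (Nat.lcm a s.lcm).primeFactors, p ≤ _
    have hpf : (Nat.lcm a s.lcm).primeFactors = a.primeFactors ∪ s.lcm.primeFactors := by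
      ext p
      have hl : Nat.lcm a s.lcm ≠ 0 := Nat.lcm_ne_zero ha hs
      simp only [Finset.mem_union, Nat.mem_primeFactors, ne_eq, ha, hs, hl, not_false_eq_true,
        and_true, ← and_or_left]
      exact and_congr_right fun hp => hp.dvd_lcm
    rw [hpf]
    have h1 : ∑ p ∈ a.primeFactors, p ≤ a :=
      (Finset.sum_le_prod_of_two_le fun p hp => (Nat.prime_of_mem_primeFactors hp).two_le).trans
        (Nat.le_of_dvd (Nat.pos_of_ne_zero ha) (Nat.prod_primeFactors_dvd a))
    have h2 := Finset.sum_union_inter (s₁ := a.primeFactors) (s₂ := s.lcm.primeFactors)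
      (f := fun p : ℕ => p)
    have := ih h.2
    omega

/-- The full power of `p` in the lcm already divides a single member. -/
theorem Multiset.pow_factorization_lcm_le {s : Multiset ℕ} (h : 0 ∉ s) (hs : s ≠ 0) (p : ℕ) :
    p ^ s.lcm.factorization p ≤ s.sum := by
  induction s using Multiset.induction_on with
  | empty => exact absurd rfl hs
  | cons a s ih =>
    simp only [Multiset.mem_cons, not_or] at h
    have ha : a ≠ 0 := fun h0 => h.1 h0.symm
    have hl : s.lcm ≠ 0 := by rw [Ne, Multiset.lcm_eq_zero_iff]; exact h.2
    have hle : p ^ a.factorization p ≤ a + s.sum :=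
      (Nat.le_of_dvd (Nat.pos_of_ne_zero ha) (Nat.ordProj_dvd a p)).trans (Nat.le_add_right _ _)
    rw [Multiset.lcm_cons, Multiset.sum_cons]
    change p ^ (Nat.lcm a s.lcm).factorization p ≤ _
    rw [Nat.factorization_lcm ha hl, Finsupp.sup_apply]
    rcases le_total (a.factorization p) (s.lcm.factorization p) with hc | hc
    · rw [max_eq_right hc]
      rcases eq_or_ne s 0 with rfl | hs0
      · simp only [Multiset.lcm_zero, Nat.factorization_one, Finsupp.coe_zero, Pi.zero_apply,
          pow_zero]
        omega
      · exact (ih h.2 hs0).trans (Nat.le_add_left _ _)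
    · rwa [max_eq_left hc]

theorem Nat.le_pow_card_primeFactors {m n : ℕ} (hm : m ≠ 0)
    (h : ∀ p ∈ m.primeFactors, p ^ m.factorization p ≤ n) : m ≤ n ^ m.primeFactors.card := by
  conv_lhs => rw [← Nat.prod_factorization_pow_eq_self hm]
  rw [Nat.prod_factorization_eq_prod_primeFactors]
  exact Finset.prod_le_pow_card _ _ _ h

/-- A number whose prime factors sum to at most `n` has few prime factors. -/
theorem card_primeFactors_le {m n : ℕ} (h : ∑ p ∈ m.primeFactors, p ≤ n) {y : ℝ} (hy : 0 < y) :
    (m.primeFactors.card : ℝ) ≤ Nat.primeCounting ⌊y⌋₊ + n / y := by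
  -- At most `n / y` of the primes exceed `y`, because of their sum.
  rw [← Finset.card_filter_add_card_filter_not (fun p : ℕ => p ≤ ⌊y⌋₊), Nat.cast_add]
  refine add_le_add ?_ ?_
  · rw [← Nat.primesLE_card_eq_primeCounting]
    refine Nat.cast_le.2 (Finset.card_le_card fun p hp => ?_)
    rw [Finset.mem_filter] at hp
    exact Nat.mem_primesLE.2 ⟨hp.2, Nat.prime_of_mem_primeFactors hp.1⟩
  · rw [le_div_iff₀ hy, ← nsmul_eq_mul]
    refine (Finset.card_nsmul_le_sum _ (fun p : ℕ => (p : ℝ)) y fun p hp => ?_).trans ?_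
    · rw [Finset.mem_filter, not_le] at hp
      exact ((Nat.floor_lt hy.le).1 hp.2).le
    · refine (Finset.sum_le_sum_of_subset_of_nonneg (Finset.filter_subset _ _)
        fun _ _ _ => Nat.cast_nonneg _).trans ?_
      rw [← Nat.cast_sum]
      exact Nat.cast_le.2 h

/-- This cutoff balances the two terms: Chebyshev bounds the first by a multiple of `y / log n`, and
`n / y` has the same order. -/
theorem primeCounting_floor_mul_log_le {n : ℕ} (hn : 2 ≤ n) {y : ℝ}
    (hy : y = 2 * √((n : ℝ) * Real.log n)) :
    0 < y ∧ ((Nat.primeCounting ⌊y⌋₊ : ℝ) + n / y) * Real.log n ≤ 10 * y := by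
  have hn' : (2 : ℝ) ≤ n := by exact_mod_cast hn
  have hl2 := Real.log_two_gt_d9
  have hl2' := Real.log_two_lt_d9
  have hlog : Real.log 2 ≤ Real.log n := Real.log_le_log (by norm_num) hn'
  have hnl : 0 ≤ (n : ℝ) * Real.log n := by positivity
  have hy2 : y ^ 2 = 4 * (n * Real.log n) := by
    rw [hy, mul_pow, Real.sq_sqrt hnl]; norm_num
  have hny : (n : ℝ) ≤ y ^ 2 := by rw [hy2]; nlinarith
  have hy0 : 0 ≤ y := by rw [hy]; positivity
  have hy1 : 1 < y := by nlinarith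
  have hpos : 0 < y := by linarith
  refine ⟨hpos, ?_⟩
  have hs : √y ^ 2 = y := Real.sq_sqrt hy0
  have hs1 : 1 < √y := by rw [Real.lt_sqrt] <;> linarith
  have hlogle : Real.log n ≤ 4 * Real.log √y := by
    have : (n : ℝ) ≤ √y ^ 4 := by
      rw [show √y ^ 4 = (√y ^ 2) ^ 2 by ring, hs]; exact hny
    have := Real.log_le_log (by linarith) this
    rwa [Real.log_pow] at this
  have hls : 0 < Real.log √y := Real.log_pos hs1
  have hls' : Real.log √y ≤ √y := (Real.log_le_sub_one_of_pos (by linarith)).trans (by linarith)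
  have hpi := Chebyshev.pi_le_log4_mul_div hy1
  have h4 : Real.log 4 ≤ 1.4 := by
    rw [show (4 : ℝ) = 2 ^ 2 by norm_num, Real.log_pow]; push_cast; linarith
  have h1 : Real.log 4 * y / Real.log √y * Real.log n ≤ 5.6 * y := by
    rw [div_mul_eq_mul_div, div_le_iff₀ hls]
    calc Real.log 4 * y * Real.log n ≤ 1.4 * y * (4 * Real.log √y) := by gcongr
      _ = 5.6 * y * Real.log √y := by ring
  have h2 : √y * Real.log n ≤ 4 * y := by
    calc √y * Real.log n ≤ √y * (4 * √y) := by gcongr; linarith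
      _ = 4 * √y ^ 2 := by ring
      _ = 4 * y := by rw [hs]
  have h3 : (n : ℝ) / y * Real.log n = y / 4 := by
    field_simp
    linarith
  have h5 := mul_le_mul_of_nonneg_right hpi (by linarith : 0 ≤ Real.log n)
  rw [add_mul] at h5 ⊢
  linarith

/-- The order of a permutation of `n` points is at most `exp (20 * √(n * log n))`. -/
theorem log_orderOf_perm_le {V : Type*} [Fintype V] (hV : 2 ≤ Fintype.card V)
    (f : Equiv.Perm V) :
    Real.log (orderOf f) ≤ 20 * √((Fintype.card V : ℝ) * Real.log (Fintype.card V)) := by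
  classical
  set n := Fintype.card V with hn
  obtain ⟨hy, hle⟩ := primeCounting_floor_mul_log_le hV rfl
  have h0 : 0 ∉ f.cycleType := fun h => by
    have := Equiv.Perm.two_le_of_mem_cycleType h
    omega
  have hsum : f.cycleType.sum ≤ n := by
    rw [Equiv.Perm.sum_cycleType]
    exact Finset.card_le_univ _
  have hpf : ∀ p ∈ (orderOf f).primeFactors, p ^ (orderOf f).factorization p ≤ n := by
    intro p hp
    rw [← Equiv.Perm.lcm_cycleType] at hp ⊢
    refine (Multiset.pow_factorization_lcm_le h0 ?_ p).trans hsum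
    rintro h
    rw [h] at hp
    simp at hp
  have hps : ∑ p ∈ (orderOf f).primeFactors, p ≤ n := by
    rw [← Equiv.Perm.lcm_cycleType]
    exact (Multiset.sum_primeFactors_lcm_le h0).trans hsum
  have hpos : 0 < orderOf f := orderOf_pos f
  have hm := Nat.le_pow_card_primeFactors hpos.ne' hpf
  have hlog : Real.log (orderOf f) ≤ (orderOf f).primeFactors.card * Real.log n := by
    rw [← Real.log_pow]
    exact Real.log_le_log (by exact_mod_cast hpos) (by exact_mod_cast hm)
  calc Real.log (orderOf f) ≤ (orderOf f).primeFactors.card * Real.log n := hlog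
    _ ≤ _ := mul_le_mul_of_nonneg_right (card_primeFactors_le hps hy) (Real.log_natCast_nonneg n)
    _ ≤ _ := hle
    _ = _ := by ring

/-- Prime powers with a sum below `n` and a product of at least `exp (√(n * log n) / 60)`. -/
theorem exists_le_log_lcmUpto {n : ℕ} (hn : 160000 ≤ n) :
    ∃ x : ℕ, ∑ p ∈ Nat.primesLE x, p ^ p.log x + 3 ≤ n ∧
      √((n : ℝ) * Real.log n) / 60 + Real.log 2 ≤ Real.log (Nat.lcmUpto x) := by
  have hn' : (160000 : ℝ) ≤ n := by exact_mod_cast hn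
  have hl2 := Real.log_two_gt_d9
  have hl2' := Real.log_two_lt_d9
  have hlog : 1 ≤ Real.log n := by
    have : Real.log (2 ^ 2) ≤ Real.log n := Real.log_le_log (by norm_num) (by linarith)
    rw [Real.log_pow] at this
    push_cast at this
    linarith
  set z := √((n : ℝ) * Real.log n) with hz
  have hz2 : z ^ 2 = n * Real.log n := Real.sq_sqrt (by positivity)
  have hz0 : 0 ≤ z := Real.sqrt_nonneg _
  -- The fourth root of `n` is at least 20 since `160000 = 20 ^ 4`. It bounds `x` from below, which
  -- makes `log n` and `log x` comparable.
  set t := √√(n : ℝ) with ht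
  have ht2 : t ^ 2 = √(n : ℝ) := Real.sq_sqrt (Real.sqrt_nonneg _)
  have ht4 : t ^ 4 = n := by
    rw [show t ^ 4 = (t ^ 2) ^ 2 by ring, ht2, Real.sq_sqrt (by positivity)]
  have ht20 : 20 ≤ t := by
    rw [ht]
    refine Real.le_sqrt_of_sq_le (Real.le_sqrt_of_sq_le ?_)
    norm_num; linarith
  have htz : t ^ 2 ≤ z := by
    rw [ht2, hz]
    exact Real.sqrt_le_sqrt (by nlinarith)
  -- The divisor 10 is large enough for `π(x) * x ≤ n / 5`, as `2.4 * 8 / 100 < 1 / 5`.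
  set x := ⌊z / 10⌋₊ with hx
  have hxle : (x : ℝ) ≤ z / 10 := Nat.floor_le (by positivity)
  have hxge : z / 10 - 1 < x := Nat.sub_one_lt_floor _
  have hxt : t ≤ x := by nlinarith
  have hx20 : (20 : ℝ) ≤ x := ht20.trans hxt
  refine ⟨x, ?_, ?_⟩
  · have hsum : ∑ p ∈ Nat.primesLE x, p ^ p.log x ≤ Nat.primeCounting x * x := by
      rw [← Nat.primesLE_card_eq_primeCounting, ← smul_eq_mul]
      refine Finset.sum_le_card_nsmul _ _ _ fun p hp => Nat.pow_log_le_self p ?_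
      rintro h0
      rw [h0] at hx20
      norm_num at hx20
    have hpi := Chebyshev.pi_le_log4_mul_div (x := (x : ℝ)) (by linarith)
    rw [Nat.floor_natCast] at hpi
    have hlogle : Real.log n ≤ 8 * Real.log √(x : ℝ) := by
      have h1 : (n : ℝ) ≤ (x : ℝ) ^ 4 := by
        rw [← ht4]; gcongr
      have h2 := Real.log_le_log (by linarith) h1
      rw [Real.log_pow] at h2
      rw [Real.log_sqrt (by linarith)]
      push_cast at h2
      linarith
    have hls : 0 < Real.log √(x : ℝ) := by linarith
    have hsx : √(x : ℝ) ^ 2 = x := Real.sq_sqrt (by linarith)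
    have hls' : Real.log √(x : ℝ) ≤ √(x : ℝ) := by
      have : 0 < √(x : ℝ) := Real.sqrt_pos.2 (by linarith)
      exact (Real.log_le_sub_one_of_pos this).trans (by linarith)
    have h4 : Real.log 4 ≤ 1.4 := by
      rw [show (4 : ℝ) = 2 ^ 2 by norm_num, Real.log_pow]; push_cast; linarith
    have h5 : √(x : ℝ) ≤ x / Real.log √(x : ℝ) := by
      rw [le_div_iff₀ hls]; nlinarith [Real.sqrt_nonneg (x : ℝ)]
    have h6 : (Nat.primeCounting x : ℝ) * x ≤ n / 5 := by
      have h7 : (Nat.primeCounting x : ℝ) ≤ 2.4 * x / Real.log √(x : ℝ) := by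
        refine hpi.trans ?_
        calc Real.log 4 * x / Real.log √(x : ℝ) + √(x : ℝ)
            ≤ 1.4 * x / Real.log √(x : ℝ) + x / Real.log √(x : ℝ) := by gcongr
          _ = _ := by ring
      calc (Nat.primeCounting x : ℝ) * x ≤ 2.4 * x / Real.log √(x : ℝ) * x := by gcongr
        _ = 2.4 * (x : ℝ) ^ 2 / Real.log √(x : ℝ) := by ring
        _ ≤ n / 5 := by
          rw [div_le_iff₀ hls]
          have h8 : (x : ℝ) ^ 2 ≤ (z / 10) ^ 2 := by gcongr
          have h9 : (n : ℝ) * Real.log n ≤ n * (8 * Real.log √(x : ℝ)) := by gcongr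
          nlinarith
    have h10 : ((∑ p ∈ Nat.primesLE x, p ^ p.log x : ℕ) : ℝ) ≤ n / 5 := by
      refine le_trans ?_ h6
      exact_mod_cast hsum
    have : ((∑ p ∈ Nat.primesLE x, p ^ p.log x + 3 : ℕ) : ℝ) ≤ n := by
      rw [Nat.cast_add]
      push_cast at h10 ⊢
      linarith
    exact_mod_cast this
  · rw [← Chebyshev.psi_eq_log_lcmUpto]
    refine le_trans ?_ (Chebyshev.psi_ge x)
    -- The tangent of the logarithm at 32 reduces the claim to a linear inequality.
    have h1 : Real.log ((x : ℝ) + 1) ≤ (x + 1) / 32 - 1 + 5 * Real.log 2 := by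
      have h2 := Real.log_le_sub_one_of_pos (x := ((x : ℝ) + 1) / 32) (by positivity)
      rw [Real.log_div (by positivity) (by norm_num), show (32 : ℝ) = 2 ^ 5 by norm_num,
        Real.log_pow] at h2
      push_cast at h2
      linarith
    nlinarith

end Landau

theorem List.lex_cons_cons_iff' {α : Type*} {r : α → α → Prop} {a b : α} {s t : List α} :
    List.Lex r (a :: s) (b :: t) ↔ r a b ∨ a = b ∧ List.Lex r s t := by
  constructor
  · intro h
    cases h with
    | cons h => exact Or.inr ⟨rfl, h⟩
    | rel h => exact Or.inl h
  · rintro (h | ⟨rfl, h⟩)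
    · exact List.Lex.rel h
    · exact List.Lex.cons h

theorem IsSuccessor.unique {α : Type*} [LinearOrder α] {L : Language α} {u v v' : List α}
    (h : IsSuccessor L u v) (h' : IsSuccessor L u v') : v = v' :=
  Std.Trichotomous.trichotomous (r := List.Shortlex (· < ·)) v v'
    (fun hlt => h'.2.2 v h.1 hlt h.2.1) (fun hlt => h.2.2 v' h'.1 hlt h'.2.1)

/-! ### Live sets and lexicographic successors among words of equal length. -/

namespace DFA

variable {α σ : Type*} (A : DFA α σ)

/-- The states from which some word of length `k` is accepted. -/
def live (k : ℕ) : Set σ := {q | ∃ w : List α, w.length = k ∧ A.evalFrom q w ∈ A.accept}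

/-- The states with a transition into `S`. -/
def pred (S : Set σ) : Set σ := {q | ∃ a, A.step q a ∈ S}

theorem live_zero : A.live 0 = A.accept := by
  ext q
  simp [live, List.length_eq_zero_iff]

theorem live_succ (k : ℕ) : A.live (k + 1) = A.pred (A.live k) := by
  ext q
  constructor
  · rintro ⟨_ | ⟨a, w⟩, hw, h⟩
    · simp at hw
    · exact ⟨a, w, by simpa using hw, h⟩
  · rintro ⟨a, w, hw, h⟩
    exact ⟨a :: w, by simpa using hw, h⟩

theorem mem_live_iff_isWalk {k : ℕ} {q : σ} :
    q ∈ A.live k ↔ ∃ f ∈ A.accept, IsWalk (fun p q => ∃ a, A.step p a = q) k q f := by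
  induction k generalizing q with
  | zero => simp [live_zero, IsWalk]
  | succ k ih =>
    rw [live_succ]
    constructor
    · rintro ⟨a, h⟩
      obtain ⟨f, hf, h⟩ := ih.1 h
      exact ⟨f, hf, _, ⟨a, rfl⟩, h⟩
    · rintro ⟨f, hf, _, ⟨a, rfl⟩, h⟩
      exact ⟨a, ih.2 ⟨f, hf, h⟩⟩

/-- The sets `A.live k` are few. -/
theorem ncard_range_live_le [Fintype σ] : ∃ f : Equiv.Perm σ,
    (Set.range A.live).ncard ≤ Fintype.card σ + orderOf f * (Fintype.card σ + 1) := by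
  obtain ⟨f, hf⟩ := exists_perm_forall_isWalk_add_orderOf fun p q => ∃ a, A.step p a = q
  refine ⟨f, ncard_range_le_of_subset_add _ (orderOf_pos f) fun k hk q hq => ?_⟩
  rw [mem_live_iff_isWalk] at hq ⊢
  obtain ⟨r, hr, h⟩ := hq
  exact ⟨r, hr, hf k q r hk h⟩

variable [LinearOrder α]

/-- No word of the length of `u` that is lexicographically larger than `u` is accepted from `p`. -/
def NoGreater (p : σ) (u : List α) : Prop :=
  ∀ w : List α, w.length = u.length → List.Lex (· < ·) u w → A.evalFrom p w ∉ A.accept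

/-- `v` is the lexicographically least word of length `k` accepted from `q`. -/
def IsLeastFrom (q : σ) (k : ℕ) (v : List α) : Prop :=
  v.length = k ∧ A.evalFrom q v ∈ A.accept ∧
    ∀ w : List α, w.length = k → List.Lex (· < ·) w v → A.evalFrom q w ∉ A.accept

/-- `v` is the lexicographic successor of `u` among the words of its length accepted from `p`. -/
def IsNextFrom (p : σ) (u v : List α) : Prop :=
  v.length = u.length ∧ List.Lex (· < ·) u v ∧ A.evalFrom p v ∈ A.accept ∧
    ∀ w : List α, w.length = u.length → List.Lex (· < ·) u w → List.Lex (· < ·) w v →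
      A.evalFrom p w ∉ A.accept

/-- `b` is the least letter that leads from `q` to `S`. -/
def IsLeastLetter (q : σ) (S : Set σ) (b : α) : Prop :=
  A.step q b ∈ S ∧ ∀ c < b, A.step q c ∉ S

/-- `b` is the least letter above `a` that leads from `q` to `S`. -/
def IsNextLetter (q : σ) (S : Set σ) (a b : α) : Prop :=
  a < b ∧ A.step q b ∈ S ∧ ∀ c, a < c → c < b → A.step q c ∉ S

variable {A}

theorem IsLeastLetter.unique {q : σ} {S : Set σ} {b c : α} (hb : A.IsLeastLetter q S b)
    (hc : A.IsLeastLetter q S c) : b = c := by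
  rcases lt_trichotomy b c with h | h | h
  · exact absurd hb.1 (hc.2 b h)
  · exact h
  · exact absurd hc.1 (hb.2 c h)

theorem IsNextLetter.unique {q : σ} {S : Set σ} {a b c : α} (hb : A.IsNextLetter q S a b)
    (hc : A.IsNextLetter q S a c) : b = c := by
  rcases lt_trichotomy b c with h | h | h
  · exact absurd hb.2.1 (hc.2.2 b hb.1 h)
  · exact h
  · exact absurd hc.2.1 (hb.2.2 c hc.1 h)

theorem exists_isLeastLetter [Finite α] {q : σ} {S : Set σ} (h : q ∈ A.pred S) :
    ∃ b, A.IsLeastLetter q S b := by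
  obtain ⟨b, hb, hmin⟩ := wellFounded_lt.has_min {b | A.step q b ∈ S} h
  exact ⟨b, hb, fun c hc h => hmin c h hc⟩

theorem exists_isNextLetter [Finite α] {q : σ} {S : Set σ} {a : α}
    (h : ∃ b, a < b ∧ A.step q b ∈ S) : ∃ b, A.IsNextLetter q S a b := by
  obtain ⟨b, hb, hmin⟩ := wellFounded_lt.has_min {b | a < b ∧ A.step q b ∈ S} h
  exact ⟨b, hb.1, hb.2, fun c hac hc h => hmin c ⟨hac, h⟩ hc⟩

theorem noGreater_nil {p : σ} : A.NoGreater p [] := by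
  intro w hw h
  rw [List.length_nil, List.length_eq_zero_iff] at hw
  subst hw
  cases h

theorem noGreater_cons {p : σ} {a : α} {u : List α} :
    A.NoGreater p (a :: u) ↔
      (∀ b, a < b → A.step p b ∉ A.live u.length) ∧ A.NoGreater (A.step p a) u := by
  constructor
  · refine fun h => ⟨?_, ?_⟩
    · rintro b hb ⟨w, hw, hacc⟩
      exact h (b :: w) (by simp [hw]) (List.Lex.rel hb) hacc
    · intro w hw hlex hacc
      exact h (a :: w) (by simp [hw]) (List.Lex.cons hlex) hacc
  · rintro ⟨h1, h2⟩ (_ | ⟨b, w⟩) hw hlex hacc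
    · simp at hw
    · have hw' : w.length = u.length := by simpa using hw
      obtain hab | ⟨rfl, hl⟩ := List.lex_cons_cons_iff'.1 hlex
      · exact h1 b hab ⟨w, hw', hacc⟩
      · exact h2 w hw' hl hacc

theorem IsLeastFrom.cons {q : σ} {k : ℕ} {b : α} {v : List α}
    (hb : A.IsLeastLetter q (A.live k) b) (h : A.IsLeastFrom (A.step q b) k v) :
    A.IsLeastFrom q (k + 1) (b :: v) := by
  refine ⟨by simp [h.1], h.2.1, ?_⟩
  rintro (_ | ⟨c, w⟩) hw hlex hacc
  · simp at hw
  · have hw' : w.length = k := by simpa using hw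
    obtain hcb | ⟨rfl, hl⟩ := List.lex_cons_cons_iff'.1 hlex
    · exact hb.2 c hcb ⟨w, hw', hacc⟩
    · exact h.2.2 w hw' hl hacc

theorem IsNextFrom.cons_self {p : σ} {a : α} {u v : List α}
    (h : A.IsNextFrom (A.step p a) u v) : A.IsNextFrom p (a :: u) (a :: v) := by
  refine ⟨by simp [h.1], List.Lex.cons h.2.1, h.2.2.1, ?_⟩
  rintro (_ | ⟨c, w⟩) hw hl hl' hacc
  · simp at hw
  · have hw' : w.length = u.length := by simpa using hw
    obtain h1 | ⟨rfl, h1⟩ := List.lex_cons_cons_iff'.1 hl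
    · obtain h2 | ⟨rfl, h2⟩ := List.lex_cons_cons_iff'.1 hl'
      · exact lt_asymm h1 h2
      · exact lt_irrefl _ h1
    · obtain h2 | ⟨-, h2⟩ := List.lex_cons_cons_iff'.1 hl'
      · exact lt_irrefl _ h2
      · exact h.2.2.2 w hw' h1 h2 hacc

theorem IsNextFrom.cons {p : σ} {a b : α} {u v : List α}
    (hb : A.IsNextLetter p (A.live u.length) a b) (hu : A.NoGreater (A.step p a) u)
    (hv : A.IsLeastFrom (A.step p b) u.length v) : A.IsNextFrom p (a :: u) (b :: v) := by
  refine ⟨by simp [hv.1], List.Lex.rel hb.1, hv.2.1, ?_⟩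
  rintro (_ | ⟨c, w⟩) hw hl hl' hacc
  · simp at hw
  · have hw' : w.length = u.length := by simpa using hw
    obtain h1 | ⟨rfl, h1⟩ := List.lex_cons_cons_iff'.1 hl
    · obtain h2 | ⟨rfl, h2⟩ := List.lex_cons_cons_iff'.1 hl'
      · exact hb.2.2 c h1 h2 ⟨w, hw', hacc⟩
      · exact hv.2.2 w hw' h2 hacc
    · exact hu w hw' h1 hacc

/-! ### The successor transducer. -/

variable (A)

/-- The states of the successor transducer. The set `S` tells which states accept a word of the
length of the remaining output. In the state `pre p S`, the input was copied; in the state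
`post p q S`, the automaton `A` is in the state `p` after the input and in the state `q` after the
output; in the state `pad q S`, no input was read. -/
inductive SuccState : Type _
  | start : SuccState
  | pre (p : σ) (S : Set.range A.live) : SuccState
  | post (p q : σ) (S : Set.range A.live) : SuccState
  | pad (q : σ) (S : Set.range A.live) : SuccState

/-- `A.SuccStep x a y b`: the successor transducer has a transition from `x` to `y` that reads `a`
and writes `b`. -/
inductive SuccStep : A.SuccState → Option α → A.SuccState → Option α → Prop
  | initPre (S : Set.range A.live) : SuccStep .start none (.pre A.start S) none
  | initPad {S : Set.range A.live} : A.start ∈ S.1 →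
      SuccStep .start none (.pad A.start S) none
  | copy {p : σ} {a : α} {S S' : Set.range A.live} : A.pred S'.1 = S.1 →
      SuccStep (.pre p S) (some a) (.pre (A.step p a) S') (some a)
  | diverge {p : σ} {a b : α} {S S' : Set.range A.live} : A.pred S'.1 = S.1 →
      A.IsNextLetter p S'.1 a b →
      SuccStep (.pre p S) (some a) (.post (A.step p a) (A.step p b) S') (some b)
  | follow {p q : σ} {a b : α} {S S' : Set.range A.live} : A.pred S'.1 = S.1 →
      (∀ c, a < c → A.step p c ∉ S'.1) → A.IsLeastLetter q S'.1 b →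
      SuccStep (.post p q S) (some a) (.post (A.step p a) (A.step q b) S') (some b)
  | padStay {q : σ} {b : α} {S S' : Set.range A.live} : A.pred S'.1 = S.1 →
      A.IsLeastLetter q S'.1 b → A.start ∉ S'.1 →
      SuccStep (.pad q S) none (.pad (A.step q b) S') (some b)
  | padDone {q : σ} {b : α} {S S' : Set.range A.live} : A.pred S'.1 = S.1 →
      A.IsLeastLetter q S'.1 b →
      SuccStep (.pad q S) none (.post A.start (A.step q b) S') (some b)

/-- The transducer that maps each word to its `A.accepts`-successor. -/
def succTransducer : Transducer α α A.SuccState where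
  step x a := {y | A.SuccStep x a y.1 y.2}
  start := .start
  accept := {x | ∃ (p q : σ) (S : Set.range A.live), S.1 = A.accept ∧ x = .post p q S}

/-- `r` leads from `x` to acceptance and reads `u`. -/
def Finishes (x : A.SuccState) (u : List α)
    (r : List (Option α × Option α × A.SuccState)) : Prop :=
  Transducer.inputWord r = u ∧ ∃ y ∈ A.succTransducer.accept, A.succTransducer.IsPath x r y

end DFA

namespace Transducer

variable {α β σ : Type*}

@[simp] theorem inputWord_nil : inputWord ([] : List (Option α × Option β × σ)) = [] := rfl

@[simp] theorem inputWord_cons_some (a : α) (b : Option β) (q : σ)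
    (r : List (Option α × Option β × σ)) :
    inputWord ((some a, b, q) :: r) = a :: inputWord r := rfl

@[simp] theorem outputWord_cons_none (a : Option α) (q : σ)
    (r : List (Option α × Option β × σ)) :
    outputWord ((a, none, q) :: r) = outputWord r := rfl

end Transducer

/-! ### Correctness and unambiguity of the successor transducer. -/

namespace DFA

open Transducer

variable {α σ : Type*} [LinearOrder α] {A : DFA α σ}

theorem finishes_nil {x : A.SuccState} {u : List α} :
    A.Finishes x u [] ↔ u = [] ∧ x ∈ A.succTransducer.accept := by
  constructor
  · rintro ⟨rfl, y, hy, h⟩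
    cases h
    exact ⟨rfl, hy⟩
  · rintro ⟨rfl, hx⟩
    exact ⟨rfl, x, hx, .nil x⟩

theorem finishes_cons_some {x y : A.SuccState} {a : α} {b : Option α} {u : List α}
    {r : List (Option α × Option α × A.SuccState)} :
    A.Finishes x u ((some a, b, y) :: r) ↔
      ∃ u', u = a :: u' ∧ A.SuccStep x (some a) y b ∧ A.Finishes y u' r := by
  constructor
  · rintro ⟨rfl, z, hz, h⟩
    cases h with
    | cons hs h => exact ⟨_, rfl, hs, rfl, z, hz, h⟩
  · rintro ⟨_, rfl, hs, rfl, z, hz, h⟩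
    exact ⟨rfl, z, hz, .cons hs h⟩

theorem finishes_cons_none {x y : A.SuccState} {b : Option α} {u : List α}
    {r : List (Option α × Option α × A.SuccState)} :
    A.Finishes x u ((none, b, y) :: r) ↔ A.SuccStep x none y b ∧ A.Finishes y u r := by
  constructor
  · rintro ⟨rfl, z, hz, h⟩
    cases h with
    | cons hs h => exact ⟨hs, rfl, z, hz, h⟩
  · rintro ⟨hs, rfl, z, hz, h⟩
    exact ⟨rfl, z, hz, .cons hs h⟩

/-- The guesses are verified backwards from acceptance, so each must be the true live set. The
choice of letters preserves `hq`, which at the end says that the output is accepted. -/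
theorem finishes_post {p q : σ} {S : Set.range A.live} {u : List α}
    {r : List (Option α × Option α × A.SuccState)} (h₀ : A.Finishes (.post p q S) u r)
    (hq : q ∈ S.1) :
    S.1 = A.live u.length ∧ r.length = u.length ∧ A.NoGreater p u ∧
      A.IsLeastFrom q u.length (outputWord r) := by
  induction r generalizing p q S u with
  | nil =>
    obtain ⟨rfl, _, _, _, hS, heq⟩ := finishes_nil.1 h₀
    cases heq
    refine ⟨by rw [hS, List.length_nil, live_zero], rfl, noGreater_nil, rfl, hS ▸ hq, ?_⟩
    rintro w - h
    cases h
  | cons t r ih =>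
    obtain ⟨_ | a, b, y⟩ := t
    · cases (finishes_cons_none.1 h₀).1
    · obtain ⟨u, rfl, hs, h⟩ := finishes_cons_some.1 h₀
      cases hs with
      | follow hS hno hb =>
        obtain ⟨hS', hr, hu, hv⟩ := ih h hb.1
        rw [hS'] at hno hb hS
        refine ⟨by rw [← hS, List.length_cons, live_succ], by simp [hr],
          noGreater_cons.2 ⟨hno, hu⟩, hv.cons hb⟩

theorem finishes_post_unique {p q : σ} {S : Set.range A.live} {u : List α}
    {r r' : List (Option α × Option α × A.SuccState)} (h₀ : A.Finishes (.post p q S) u r)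
    (h₀' : A.Finishes (.post p q S) u r') (hq : q ∈ S.1) : r = r' := by
  induction r generalizing p q S u r' with
  | nil =>
    have h1 := (finishes_post h₀ hq).2.1
    have h2 := (finishes_post h₀' hq).2.1
    rw [← h1, List.length_nil, List.length_eq_zero_iff] at h2
    exact h2.symm
  | cons t r ih =>
    obtain ⟨_ | a, b, y⟩ := t
    · cases (finishes_cons_none.1 h₀).1
    obtain ⟨u, rfl, hs, h⟩ := finishes_cons_some.1 h₀
    obtain _ | ⟨⟨_ | a', b', y'⟩, r'⟩ := r'
    · simpa using (finishes_nil.1 h₀').1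
    · cases (finishes_cons_none.1 h₀').1
    obtain ⟨u', he, hs', h'⟩ := finishes_cons_some.1 h₀'
    cases he
    cases hs with
    | @follow _ _ _ b _ S₁ hS hno hb =>
      cases hs' with
      | @follow _ _ _ b' _ S₂ hS' hno' hb' =>
        obtain rfl : S₁ = S₂ :=
          Subtype.ext ((finishes_post h hb.1).1.trans (finishes_post h' hb'.1).1.symm)
        obtain rfl := hb.unique hb'
        rw [ih h h' hb.1]

theorem exists_finishes_post [Finite α] {p q : σ} {u : List α} (hq : q ∈ A.live u.length)
    (hu : A.NoGreater p u) : ∃ r, A.Finishes (.post p q ⟨A.live u.length, _, rfl⟩) u r := by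
  induction u generalizing p q with
  | nil => exact ⟨[], finishes_nil.2 ⟨rfl, p, q, _, A.live_zero, rfl⟩⟩
  | cons a u ih =>
    rw [List.length_cons, live_succ] at hq
    obtain ⟨b, hb⟩ := exists_isLeastLetter hq
    obtain ⟨hno, hu⟩ := noGreater_cons.1 hu
    obtain ⟨r, hr⟩ := ih hb.1 hu
    exact ⟨_, finishes_cons_some.2 ⟨u, rfl, .follow (A.live_succ _).symm hno hb, hr⟩⟩

theorem finishes_pre {p : σ} {S : Set.range A.live} {u : List α}
    {r : List (Option α × Option α × A.SuccState)} (h₀ : A.Finishes (.pre p S) u r) :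
    S.1 = A.live u.length ∧ A.IsNextFrom p u (outputWord r) := by
  induction r generalizing p S u with
  | nil =>
    obtain ⟨-, _, _, _, -, heq⟩ := finishes_nil.1 h₀
    cases heq
  | cons t r ih =>
    obtain ⟨_ | a, b, y⟩ := t
    · cases (finishes_cons_none.1 h₀).1
    · obtain ⟨u, rfl, hs, h⟩ := finishes_cons_some.1 h₀
      cases hs with
      | copy hS =>
        obtain ⟨hS', hv⟩ := ih h
        rw [hS'] at hS
        exact ⟨by rw [← hS, List.length_cons, live_succ], hv.cons_self⟩
      | diverge hS hb =>
        obtain ⟨hS', hr, hu, hv⟩ := finishes_post h hb.2.1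
        rw [hS'] at hS hb
        exact ⟨by rw [← hS, List.length_cons, live_succ], .cons hb hu hv⟩

/-- Copying a letter requires a greater accepted continuation of the remaining input, and diverging
forbids one. The guessed sets are forced. -/
theorem finishes_pre_unique {p : σ} {S : Set.range A.live} {u : List α}
    {r r' : List (Option α × Option α × A.SuccState)} (h₀ : A.Finishes (.pre p S) u r)
    (h₀' : A.Finishes (.pre p S) u r') : r = r' := by
  induction r generalizing p S u r' with
  | nil =>
    obtain ⟨-, _, _, _, -, heq⟩ := finishes_nil.1 h₀
    cases heq
  | cons t r ih =>
    obtain ⟨_ | a, b, y⟩ := t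
    · cases (finishes_cons_none.1 h₀).1
    obtain ⟨u, rfl, hs, h⟩ := finishes_cons_some.1 h₀
    obtain _ | ⟨⟨_ | a', b', y'⟩, r'⟩ := r'
    · simpa using (finishes_nil.1 h₀').1
    · cases (finishes_cons_none.1 h₀').1
    obtain ⟨u', he, hs', h'⟩ := finishes_cons_some.1 h₀'
    cases he
    cases hs with
    | @copy _ _ _ S₁ hS =>
      have hp := finishes_pre h
      cases hs' with
      | @copy _ _ _ S₂ hS' =>
        obtain rfl : S₁ = S₂ := Subtype.ext (hp.1.trans (finishes_pre h').1.symm)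
        rw [ih h h']
      | @diverge _ _ b' _ S₂ hS' hb' =>
        exact absurd hp.2.2.2.1 ((finishes_post h' hb'.2.1).2.2.1 _ hp.2.1 hp.2.2.1)
    | @diverge _ _ b _ S₁ hS hb =>
      have hp := finishes_post h hb.2.1
      cases hs' with
      | @copy _ _ _ S₂ hS' =>
        have hp' := finishes_pre h'
        exact absurd hp'.2.2.2.1 (hp.2.2.1 _ hp'.2.1 hp'.2.2.1)
      | @diverge _ _ b' _ S₂ hS' hb' =>
        obtain rfl : S₁ = S₂ := Subtype.ext (hp.1.trans (finishes_post h' hb'.2.1).1.symm)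
        obtain rfl := hb.unique hb'
        rw [finishes_post_unique h h' hb.2.1]

theorem exists_finishes_pre [Finite α] {p : σ} {u : List α} (hu : ¬A.NoGreater p u) :
    ∃ r, A.Finishes (.pre p ⟨A.live u.length, _, rfl⟩) u r := by
  induction u generalizing p with
  | nil => exact absurd noGreater_nil hu
  | cons a u ih =>
    -- The output must leave the input at the last position where it can.
    by_cases h : A.NoGreater (A.step p a) u
    · rw [noGreater_cons, and_iff_left h] at hu
      push Not at hu
      obtain ⟨b, hb⟩ := exists_isNextLetter hu
      obtain ⟨r, hr⟩ := exists_finishes_post hb.2.1 h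
      exact ⟨_, finishes_cons_some.2 ⟨u, rfl, .diverge (A.live_succ _).symm hb, hr⟩⟩
    · obtain ⟨r, hr⟩ := ih h
      exact ⟨_, finishes_cons_some.2 ⟨u, rfl, .copy (A.live_succ _).symm, hr⟩⟩

/-- Here `d + 1` letters are written before any is read; the test in `padStay` excludes accepted
words of the intermediate lengths. -/
theorem finishes_pad {q : σ} {S : Set.range A.live} {u : List α}
    {r : List (Option α × Option α × A.SuccState)} (h₀ : A.Finishes (.pad q S) u r) :
    ∃ d, r.length = u.length + (d + 1) ∧ S.1 = A.live (u.length + (d + 1)) ∧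
      (∀ e < d, A.start ∉ A.live (u.length + (e + 1))) ∧ A.NoGreater A.start u ∧
      A.IsLeastFrom q (u.length + (d + 1)) (outputWord r) := by
  induction r generalizing q S u with
  | nil =>
    obtain ⟨-, _, _, _, -, heq⟩ := finishes_nil.1 h₀
    cases heq
  | cons t r ih =>
    obtain ⟨_ | a, b, y⟩ := t
    · obtain ⟨hs, h⟩ := finishes_cons_none.1 h₀
      cases hs with
      | padStay hS hb hstart =>
        obtain ⟨d, hr, hS', hd, hu, hv⟩ := ih h
        rw [hS'] at hS hb hstart
        refine ⟨d + 1, by simp only [List.length_cons]; omega,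
          by rw [← hS, ← live_succ]; rfl, fun e he => ?_, hu, hv.cons hb⟩
        rcases Nat.lt_succ_iff_lt_or_eq.1 he with he | rfl
        · exact hd e he
        · exact hstart
      | padDone hS hb =>
        obtain ⟨hS', hr, hu, hv⟩ := finishes_post h hb.1
        rw [hS'] at hS hb
        exact ⟨0, by simp [hr], by rw [← hS, ← live_succ], fun e he => absurd he (by omega),
          hu, hv.cons hb⟩
    · obtain ⟨u, rfl, hs, -⟩ := finishes_cons_some.1 h₀
      cases hs

/-- Equal lengths are assumed because live sets may recur, so an inner padding state need not fix
the amount of padding. Minimality at the start fixes it. -/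
theorem finishes_pad_unique {q : σ} {S : Set.range A.live} {u : List α}
    {r r' : List (Option α × Option α × A.SuccState)} (h₀ : A.Finishes (.pad q S) u r)
    (h₀' : A.Finishes (.pad q S) u r') (hlen : r.length = r'.length) : r = r' := by
  induction r generalizing q S u r' with
  | nil =>
    obtain ⟨-, _, _, _, -, heq⟩ := finishes_nil.1 h₀
    cases heq
  | cons t r ih =>
    obtain ⟨_ | a, b, y⟩ := t
    swap
    · obtain ⟨u, rfl, hs, -⟩ := finishes_cons_some.1 h₀
      cases hs
    obtain ⟨hs, h⟩ := finishes_cons_none.1 h₀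
    obtain _ | ⟨⟨_ | a', b', y'⟩, r'⟩ := r'
    · simp at hlen
    swap
    · obtain ⟨u, rfl, hs, -⟩ := finishes_cons_some.1 h₀'
      cases hs
    obtain ⟨hs', h'⟩ := finishes_cons_none.1 h₀'
    simp only [List.length_cons, Nat.add_right_cancel_iff] at hlen
    cases hs with
    | @padStay _ b _ S₁ hS hb hstart =>
      obtain ⟨d, hr, hS₁, -⟩ := finishes_pad h
      cases hs' with
      | @padStay _ b' _ S₂ hS' hb' hstart' =>
        obtain ⟨d', hr', hS₂, -⟩ := finishes_pad h'
        obtain rfl : d = d' := by omega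
        obtain rfl : S₁ = S₂ := Subtype.ext (hS₁.trans hS₂.symm)
        obtain rfl := hb.unique hb'
        rw [ih h h' hlen]
      | @padDone _ b' _ S₂ hS' hb' =>
        have := (finishes_post h' hb'.1).2.1
        omega
    | @padDone _ b _ S₁ hS hb =>
      obtain ⟨hS₁, hr, -⟩ := finishes_post h hb.1
      cases hs' with
      | @padStay _ b' _ S₂ hS' hb' hstart' =>
        obtain ⟨d', hr', -⟩ := finishes_pad h'
        omega
      | @padDone _ b' _ S₂ hS' hb' =>
        obtain rfl : S₁ = S₂ := Subtype.ext (hS₁.trans (finishes_post h' hb'.1).1.symm)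
        obtain rfl := hb.unique hb'
        rw [finishes_post_unique h h' hb.1]

theorem exists_finishes_pad [Finite α] {q : σ} {u : List α} {d : ℕ}
    (hq : q ∈ A.live (u.length + (d + 1)))
    (hd : ∀ e < d, A.start ∉ A.live (u.length + (e + 1))) (hu : A.NoGreater A.start u) :
    ∃ r, A.Finishes (.pad q ⟨A.live (u.length + (d + 1)), _, rfl⟩) u r := by
  induction d generalizing q with
  | zero =>
    rw [zero_add, live_succ] at hq
    obtain ⟨b, hb⟩ := exists_isLeastLetter hq
    obtain ⟨r, hr⟩ := exists_finishes_post hb.1 hu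
    exact ⟨_, finishes_cons_none.2 ⟨.padDone (A.live_succ _).symm hb, hr⟩⟩
  | succ d ih =>
    rw [← add_assoc, live_succ] at hq
    obtain ⟨b, hb⟩ := exists_isLeastLetter hq
    obtain ⟨r, hr⟩ := ih hb.1 fun e he => hd e (by omega)
    exact ⟨_, finishes_cons_none.2 ⟨.padStay (A.live_succ _).symm hb (hd d (by omega)), hr⟩⟩

theorem finishes_start {u : List α} {r : List (Option α × Option α × A.SuccState)}
    (h₀ : A.Finishes .start u r) :
    (∃ S r', r = (none, none, .pre A.start S) :: r' ∧ A.Finishes (.pre A.start S) u r') ∨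
      ∃ S r', r = (none, none, .pad A.start S) :: r' ∧ A.start ∈ S.1 ∧
        A.Finishes (.pad A.start S) u r' := by
  obtain _ | ⟨⟨_ | a, b, y⟩, r⟩ := r
  · obtain ⟨-, _, _, _, -, heq⟩ := finishes_nil.1 h₀
    cases heq
  · obtain ⟨hs, h⟩ := finishes_cons_none.1 h₀
    cases hs with
    | initPre S => exact Or.inl ⟨S, r, rfl, h⟩
    | initPad hS => exact Or.inr ⟨_, r, rfl, hS, h⟩
  · obtain ⟨u, rfl, hs, -⟩ := finishes_cons_some.1 h₀
    cases hs

/-- The two kinds of run exclude each other: one exhibits a greater accepted word of the input's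
length, the other denies it. Two padding runs have the same `d`, the least one with `A.start` live.
-/
theorem succTransducer_unambiguous : A.succTransducer.Unambiguous := by
  intro u r r' h₀ h₀'
  obtain ⟨S, r, rfl, h⟩ | ⟨S, r, rfl, hS, h⟩ := finishes_start h₀ <;>
    obtain ⟨S', r', rfl, h'⟩ | ⟨S', r', rfl, hS', h'⟩ := finishes_start h₀'
  · obtain rfl : S = S' := Subtype.ext ((finishes_pre h).1.trans (finishes_pre h').1.symm)
    rw [finishes_pre_unique h h']
  · obtain ⟨d, -, -, -, hu, -⟩ := finishes_pad h'
    have hp := (finishes_pre h).2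
    exact absurd hp.2.2.1 (hu _ hp.1 hp.2.1)
  · obtain ⟨d, -, -, -, hu, -⟩ := finishes_pad h
    have hp := (finishes_pre h').2
    exact absurd hp.2.2.1 (hu _ hp.1 hp.2.1)
  · obtain ⟨d, hr, hSd, hd, -⟩ := finishes_pad h
    obtain ⟨d', hr', hSd', hd', -⟩ := finishes_pad h'
    rw [hSd] at hS
    rw [hSd'] at hS'
    obtain rfl : d = d' :=
      le_antisymm (not_lt.1 fun hlt => hd d' hlt hS') (not_lt.1 fun hlt => hd' d hlt hS)
    obtain rfl : S = S' := Subtype.ext (hSd.trans hSd'.symm)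
    rw [finishes_pad_unique h h' (by omega)]

theorem isSuccessor_of_finishes_start {u : List α}
    {r : List (Option α × Option α × A.SuccState)} (h₀ : A.Finishes .start u r) :
    IsSuccessor A.accepts u (outputWord r) := by
  obtain ⟨S, r, rfl, h⟩ | ⟨S, r, rfl, hS, h⟩ := finishes_start h₀
  · obtain ⟨-, hlen, hlex, hacc, hmin⟩ := finishes_pre h
    refine ⟨List.Shortlex.of_lex hlen.symm hlex, hacc, fun w h1 h2 hw => ?_⟩
    rw [outputWord_cons_none] at h2
    rw [List.shortlex_def] at h1 h2
    obtain h1 | ⟨h1, h1'⟩ := h1 <;> obtain h2 | ⟨h2, h2'⟩ := h2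
    any_goals omega
    exact hmin w h1.symm h1' h2' hw
  · obtain ⟨d, hr, hSd, hd, hu, hlen, hacc, hmin⟩ := finishes_pad h
    refine ⟨List.Shortlex.of_length_lt ?_, hacc, fun w h1 h2 hw => ?_⟩
    · rw [outputWord_cons_none, hlen]; omega
    rw [outputWord_cons_none] at h2
    rw [List.shortlex_def] at h1 h2
    obtain h1 | ⟨h1, h1'⟩ := h1
    · obtain h2 | ⟨h2, h2'⟩ := h2
      · exact hd (w.length - u.length - 1) (by omega) ⟨w, by omega, hw⟩
      · exact hmin w (by omega) h2' hw
    · exact hu w h1.symm h1' hw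

theorem exists_finishes_start [Finite α] {u v : List α} (h : IsSuccessor A.accepts u v) :
    ∃ r, A.Finishes .start u r := by
  by_cases hu : A.NoGreater A.start u
  · have hv : ∃ d, A.start ∈ A.live (u.length + (d + 1)) := by
      obtain hlt | ⟨heq, hlex⟩ := List.shortlex_def.1 h.1
      · exact ⟨v.length - u.length - 1, v, by omega, h.2.1⟩
      · exact absurd h.2.1 (hu v heq.symm hlex)
    classical
    obtain ⟨r, hr⟩ := exists_finishes_pad (Nat.find_spec hv) (fun e he => Nat.find_min hv he) hu
    exact ⟨_, finishes_cons_none.2 ⟨.initPad (Nat.find_spec hv), hr⟩⟩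
  · obtain ⟨r, hr⟩ := exists_finishes_pre hu
    exact ⟨_, finishes_cons_none.2 ⟨.initPre _, hr⟩⟩

theorem succTransducer_maps_iff [Finite α] {u v : List α} :
    A.succTransducer.Maps u v ↔ IsSuccessor A.accepts u v := by
  constructor
  · rintro ⟨r, hr, rfl⟩
    exact isSuccessor_of_finishes_start hr
  · intro h
    obtain ⟨r, hr⟩ := exists_finishes_start h
    exact ⟨r, hr, (isSuccessor_of_finishes_start hr).unique h⟩

theorem exists_injective_succState {α σ : Type*} (A : DFA α σ) : ∃ f : A.SuccState → Unit ⊕ (σ × Set.range A.live) ⊕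
    (σ × σ × Set.range A.live) ⊕ (σ × Set.range A.live), Function.Injective f := by
  refine ⟨fun
    | .start => .inl ()
    | .pre p S => .inr (.inl (p, S))
    | .post p q S => .inr (.inr (.inl (p, q, S)))
    | .pad q S => .inr (.inr (.inr (q, S))), ?_⟩
  rintro (_ | _ | _ | _) (_ | _ | _ | _) h <;> simp_all

theorem card_succState_le {α σ : Type*} [Finite σ] (A : DFA α σ) :
    Finite A.SuccState ∧
      Nat.card A.SuccState ≤ 1 + (Nat.card σ ^ 2 + 2 * Nat.card σ) * (Set.range A.live).ncard := by
  obtain ⟨f, hf⟩ := A.exists_injective_succState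
  refine ⟨Finite.of_injective f hf, (Nat.card_le_card_of_injective f hf).trans_eq ?_⟩
  rw [Nat.card_sum, Nat.card_sum, Nat.card_sum, Nat.card_prod, Nat.card_prod, Nat.card_prod,
    Nat.card_unique, Nat.card_coe_set_eq]
  ring

end DFA

/-! ### Cutting runs and the rank bound for unambiguous transducers. -/

namespace Transducer

variable {α β σ : Type*} {T : Transducer α β σ}

theorem inputWord_append (r r' : List (Option α × Option β × σ)) :
    inputWord (r ++ r') = inputWord r ++ inputWord r' := List.filterMap_append

theorem outputWord_append (r r' : List (Option α × Option β × σ)) :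
    outputWord (r ++ r') = outputWord r ++ outputWord r' := List.filterMap_append

theorem IsPath.append {p q s : σ} {r r' : List (Option α × Option β × σ)} (h : T.IsPath p r q)
    (h' : T.IsPath q r' s) : T.IsPath p (r ++ r') s := by
  induction h with
  | nil => exact h'
  | cons hs _ ih => exact .cons hs (ih h')

theorem IsPath.split {p s x : σ} {a : Option α} {b : Option β}
    {r r' : List (Option α × Option β × σ)} (h : T.IsPath p (r ++ (a, b, x) :: r') s) :
    T.IsPath p (r ++ [(a, b, x)]) x ∧ T.IsPath x r' s := by
  induction r generalizing p with
  | nil =>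
    cases h with
    | cons hs h => exact ⟨.cons hs (.nil x), h⟩
  | cons t r ih =>
    cases h with
    | cons hs h =>
      obtain ⟨h1, h2⟩ := ih h
      exact ⟨.cons hs h1, h2⟩

/-- A run can be cut at the transition that reads a given letter of the input. -/
theorem exists_cut {r : List (Option α × Option β × σ)} {u v : List α} {a : α}
    (h : inputWord r = u ++ a :: v) : ∃ r₁ b x r₂, r = r₁ ++ (some a, b, x) :: r₂ ∧
      inputWord r₁ = u ∧ inputWord r₂ = v := by
  induction r generalizing u with
  | nil => simp at h
  | cons t r ih =>
    obtain ⟨_ | c, b, x⟩ := t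
    · obtain ⟨r₁, b', x', r₂, rfl, h1, h2⟩ := ih h
      exact ⟨(none, b, x) :: r₁, b', x', r₂, rfl, h1, h2⟩
    · rw [inputWord_cons_some] at h
      obtain _ | ⟨d, u⟩ := u
      · obtain ⟨rfl, hr⟩ := List.cons.inj h
        exact ⟨[], b, x, r, rfl, rfl, hr⟩
      · obtain ⟨rfl, hr⟩ := List.cons.inj h
        obtain ⟨r₁, b', x', r₂, rfl, h1, h2⟩ := ih hr
        exact ⟨(some c, b, x) :: r₁, b', x', r₂, rfl, by simp [h1], h2⟩

/-- Cutting at a transition that reads a letter, not between letters, makes the cut unique in spite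
of ε-transitions. -/
theorem cut_unique {r₁ r₂ r₁' r₂' : List (Option α × Option β × σ)} {a a' : α}
    {t t' : Option β × σ} (h : r₁ ++ (some a, t) :: r₂ = r₁' ++ (some a', t') :: r₂')
    (hlen : (inputWord r₁).length = (inputWord r₁').length) :
    r₁ = r₁' ∧ t = t' ∧ r₂ = r₂' := by
  induction r₁ generalizing r₁' with
  | nil =>
    obtain _ | ⟨⟨_ | c, y⟩, r₁'⟩ := r₁'
    · simp only [List.nil_append, List.cons.injEq, Prod.mk.injEq] at h
      exact ⟨rfl, h.1.2, h.2⟩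
    · simp at h
    · obtain ⟨b, x⟩ := y
      simp at hlen
  | cons s r₁ ih =>
    obtain _ | ⟨s', r₁'⟩ := r₁'
    · obtain ⟨rfl, -⟩ := List.cons.inj h
      obtain ⟨b, x⟩ := t'
      simp at hlen
    · obtain ⟨rfl, hr⟩ := List.cons.inj h
      have hlen' : (inputWord r₁).length = (inputWord r₁').length := by
        obtain ⟨_ | c, b, x⟩ := s
        · exact hlen
        · simpa using hlen
      obtain ⟨rfl, h2⟩ := ih hr hlen'
      exact ⟨rfl, h2⟩

/-- An unambiguous transducer that writes a nonempty word on the empty input has two states. -/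
theorem Unambiguous.two_le_card [Fintype σ] (hT : T.Unambiguous) {v : List β} (hv : v ≠ [])
    (h : T.Maps [] v) : 2 ≤ Fintype.card σ := by
  obtain ⟨r, hr, rfl⟩ := h
  by_contra! hlt
  have : Subsingleton σ := Fintype.card_le_one_iff_subsingleton.1 (by omega)
  obtain ⟨-, q, hq, -⟩ := id hr
  have hnil : T.IsAcceptingRun [] [] :=
    ⟨rfl, T.start, Subsingleton.elim q T.start ▸ hq, .nil _⟩
  rw [hT _ _ _ hr hnil] at hv
  exact hv rfl

/-- Some run reads `a ^ (i + 1)`, ends by reading a letter in the state `s.1`, and writes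
nothing if `s.2` holds, and a word with first letter `b` otherwise. -/
def HasPrefix (T : Transducer α β σ) (a : α) (b : β) (i : ℕ) (s : σ × Bool) : Prop :=
  ∃ r x, inputWord r = List.replicate i a ∧ T.IsPath T.start (r ++ [(some a, x, s.1)]) s.1 ∧
    (outputWord (r ++ [(some a, x, s.1)])).head? = if s.2 then none else some b

/-- Some run from `s.1` to acceptance reads `a ^ j`, and writes a word with first letter `b` if
`s.2` holds. -/
def HasSuffix (T : Transducer α β σ) (a : α) (b : β) (j : ℕ) (s : σ × Bool) : Prop :=
  ∃ r, inputWord r = List.replicate j a ∧ (∃ q ∈ T.accept, T.IsPath s.1 r q) ∧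
    (s.2 = true → (outputWord r).head? = some b)

theorem exists_hasPrefix_hasSuffix {a : α} {b : β} {i j : ℕ} {v : List β} (hv : v.head? = some b)
    (h : T.Maps (List.replicate (i + j + 1) a) v) :
    ∃ s, T.HasPrefix a b i s ∧ T.HasSuffix a b j s := by
  obtain ⟨r, ⟨hr, q, hq, hp⟩, rfl⟩ := h
  rw [add_assoc, List.replicate_add, List.replicate_succ] at hr
  obtain ⟨r₁, x, s, r₂, rfl, h1, h2⟩ := exists_cut hr
  obtain ⟨hp1, hp2⟩ := hp.split
  rw [List.append_cons, outputWord_append, List.head?_append] at hv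
  cases hh : (outputWord (r₁ ++ [(some a, x, s)])).head? with
  | none =>
    rw [hh] at hv
    exact ⟨(s, true), ⟨r₁, x, h1, hp1, hh⟩, r₂, h2, ⟨q, hq, hp2⟩, fun _ => hv⟩
  | some c =>
    rw [hh] at hv
    obtain rfl : c = b := by simpa using hv
    exact ⟨(s, false), ⟨r₁, x, h1, hp1, hh⟩, r₂, h2, ⟨q, hq, hp2⟩, fun h => nomatch h⟩

theorem exists_run_of_hasPrefix_of_hasSuffix {a : α} {b : β} {i j : ℕ} {s : σ × Bool}
    (h : T.HasPrefix a b i s) (h' : T.HasSuffix a b j s) :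
    ∃ r₁ x r₂, inputWord r₁ = List.replicate i a ∧
      T.IsAcceptingRun (List.replicate (i + j + 1) a) (r₁ ++ (some a, x, s.1) :: r₂) ∧
      (outputWord (r₁ ++ (some a, x, s.1) :: r₂)).head? = some b ∧
      (outputWord (r₁ ++ [(some a, x, s.1)])).head? = if s.2 then none else some b := by
  obtain ⟨r₁, x, h1, hp1, ho1⟩ := h
  obtain ⟨r₂, h2, ⟨q, hq, hp2⟩, ho2⟩ := h'
  refine ⟨r₁, x, r₂, h1, ⟨?_, q, hq, ?_⟩, ?_, ho1⟩
  · rw [inputWord_append, inputWord_cons_some, h1, h2, add_assoc, List.replicate_add,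
      List.replicate_succ]
  · rw [List.append_cons]
    exact hp1.append hp2
  · rw [List.append_cons, outputWord_append, List.head?_append, ho1]
    obtain ⟨s, _ | _⟩ := s
    · rfl
    · exact ho2 rfl

open Classical in
/-- The matrix that tells on which of the words `a ^ (e x + g y + 1)` an unambiguous transducer
writes a word with first letter `b` factors through twice the number of states. -/
theorem Unambiguous.exists_matrix_mul_eq [Fintype σ] {X Y : Type*} (hT : T.Unambiguous)
    (a : α) (b : β) (e : X → ℕ) (g : Y → ℕ) (v : ℕ → List β)
    (hv : ∀ k, T.Maps (List.replicate (k + 1) a) (v k)) :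
    ∃ (U : Matrix X (σ × Bool) ℚ) (W : Matrix (σ × Bool) Y ℚ),
      U * W = Matrix.of fun x y => if (v (e x + g y)).head? = some b then 1 else 0 := by
  refine ⟨Matrix.of fun x s => if T.HasPrefix a b (e x) s then 1 else 0,
    Matrix.of fun s y => if T.HasSuffix a b (g y) s then 1 else 0, ?_⟩
  ext x y
  simp only [Matrix.mul_apply, Matrix.of_apply, mul_ite, mul_one, mul_zero, ← ite_and]
  obtain ⟨r, hr, hrv⟩ := hv (e x + g y)
  -- The sum counts the pairs at which accepting runs with first output letter `b` can be cut;
  -- unambiguity leaves exactly one such pair or none.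
  split_ifs with h
  · obtain ⟨s, hs⟩ := exists_hasPrefix_hasSuffix h (hv (e x + g y))
    rw [Finset.sum_eq_single s]
    · rw [if_pos ⟨hs.2, hs.1⟩]
    · refine fun t _ hts => if_neg fun ht => hts ?_
      obtain ⟨r₁, z, r₂, h1, hrun, -, ho⟩ := exists_run_of_hasPrefix_of_hasSuffix hs.1 hs.2
      obtain ⟨r₁', z', r₂', h1', hrun', -, ho'⟩ := exists_run_of_hasPrefix_of_hasSuffix ht.2 ht.1
      obtain ⟨rfl, hzs, rfl⟩ := cut_unique (hT _ _ _ hrun hrun') (by rw [h1, h1'])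
      obtain ⟨s, f⟩ := s
      obtain ⟨t, f'⟩ := t
      simp only [Prod.mk.injEq] at hzs
      obtain ⟨rfl, rfl⟩ := hzs
      rw [ho] at ho'
      cases f <;> cases f' <;> simp_all
    · exact fun hs => absurd (Finset.mem_univ s) hs
  · refine Finset.sum_eq_zero fun s _ => if_neg fun hs => h ?_
    obtain ⟨r₁, z, r₂, -, hrun, ho, -⟩ := exists_run_of_hasPrefix_of_hasSuffix hs.2 hs.1
    rw [← hrv, hT _ _ _ hr hrun, ho]

end Transducer

/-! ### Invertibility of the residue matrix. -/

section Residues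

/-- With `J` the all-ones matrix and `R` the permutation matrix of negation, this is `(J - R) (J /
(m - 1) - R) = 1`, from `J² = m J`, `J R = R J = J` and `R² = 1`. -/
theorem ZMod.sum_ite_mul_ite {m : ℕ} [NeZero m] (hm : 2 ≤ m) (x z : ZMod m) :
    ∑ y : ZMod m, (if x + y ≠ 0 then (1 : ℚ) else 0) *
      (1 / (m - 1) - if y + z = 0 then 1 else 0) = if x = z then 1 else 0 := by
  have hm' : (m : ℚ) - 1 ≠ 0 := by
    have : (2 : ℚ) ≤ m := by exact_mod_cast hm
    linarith
  have h1 : ∀ y : ZMod m, (if x + y ≠ 0 then (1 : ℚ) else 0) *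
      (1 / (m - 1) - if y + z = 0 then 1 else 0) =
      1 / (m - 1) - (if y = -z then 1 else 0) -
        if y = -x then (1 / (m - 1) - if x = z then 1 else 0 : ℚ) else 0 := by
    intro y
    simp only [add_comm x y, ne_eq, ← eq_neg_iff_add_eq_zero]
    by_cases h : y = -x
    · subst h
      simp [neg_inj]
    · simp [h]
  simp only [h1, Finset.sum_sub_distrib, Finset.sum_ite_eq', Finset.mem_univ, if_true,
    Finset.sum_const, Finset.card_univ, ZMod.card, nsmul_eq_mul]
  field_simp
  ring

variable {ι : Type*} [Fintype ι]

/-- The matrix that tells which pairs of vectors of residues have a sum without zero entries is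
invertible. -/
theorem exists_mul_eq_one_of_residues [DecidableEq ι] (q : ι → ℕ) [∀ i, NeZero (q i)] (hq : ∀ i, 2 ≤ q i) :
    ∃ E : Matrix (∀ i, ZMod (q i)) (∀ i, ZMod (q i)) ℚ,
      (Matrix.of fun x y => if ∀ i, x i + y i ≠ 0 then 1 else 0) * E = 1 := by
  refine ⟨Matrix.of fun y z => ∏ i, (1 / ((q i : ℚ) - 1) - if y i + z i = 0 then 1 else 0), ?_⟩
  ext x z
  have h1 : ∀ y : ∀ i, ZMod (q i), (if ∀ i, x i + y i ≠ 0 then (1 : ℚ) else 0) =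
      ∏ i, if x i + y i ≠ 0 then (1 : ℚ) else 0 := fun y => by
    rw [Finset.prod_ite_zero, Finset.prod_const_one]
    simp only [Finset.mem_univ, true_imp_iff]
  simp only [Matrix.mul_apply, Matrix.of_apply, h1, ← Finset.prod_mul_distrib]
  have h2 := Finset.prod_univ_sum (fun i => (Finset.univ : Finset (ZMod (q i))))
    fun i y => (if x i + y ≠ 0 then (1 : ℚ) else 0) *
      (1 / ((q i : ℚ) - 1) - if y + z i = 0 then 1 else 0)
  rw [Fintype.piFinset_univ] at h2
  rw [← h2]
  simp only [ZMod.sum_ite_mul_ite (hq _), Matrix.one_apply, Finset.prod_ite_zero,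
    Finset.prod_const_one, Finset.mem_univ, true_imp_iff, funext_iff]

theorem exists_nat_forall_cast_eq (q : ι → ℕ) [∀ i, NeZero (q i)]
    (hq : Pairwise (Function.onFun Nat.Coprime q)) (x : ∀ i, ZMod (q i)) :
    ∃ k : ℕ, ∀ i, (k : ZMod (q i)) = x i := by
  have : NeZero (∏ i, q i) := ⟨Finset.prod_ne_zero_iff.2 fun i _ => NeZero.ne _⟩
  refine ⟨((ZMod.prodEquivPi q hq).symm x).val, fun i => ?_⟩
  have h := congrFun ((ZMod.prodEquivPi q hq).apply_symm_apply x) i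
  rw [← ZMod.natCast_zmod_val ((ZMod.prodEquivPi q hq).symm x), map_natCast] at h
  exact h

/-- An unambiguous transducer whose output on `a ^ (k + 1)` tells by its first letter whether `k`
is divisible by some of the pairwise coprime numbers `q i` has at least `(∏ i, q i) / 2` states. -/
theorem Transducer.Unambiguous.prod_le_two_mul_card [DecidableEq ι] {α β σ : Type*} [Fintype σ]
    {T : Transducer α β σ} (hT : T.Unambiguous) (q : ι → ℕ) [∀ i, NeZero (q i)]
    (h2 : ∀ i, 2 ≤ q i) (hq : Pairwise (Function.onFun Nat.Coprime q)) (a : α) (b : β)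
    (v : ℕ → List β) (hT' : ∀ k, T.Maps (List.replicate (k + 1) a) (v k))
    (hv : ∀ k, (v k).head? = some b ↔ ∀ i, (k : ZMod (q i)) ≠ 0) :
    ∏ i, q i ≤ 2 * Fintype.card σ := by
  choose e he using exists_nat_forall_cast_eq q hq
  obtain ⟨U, W, hUW⟩ := hT.exists_matrix_mul_eq a b e e v hT'
  obtain ⟨E, hE⟩ := exists_mul_eq_one_of_residues q h2
  have h1 : U * (W * E) = 1 := by
    rw [← Matrix.mul_assoc, hUW, ← hE]
    congr 2
    ext x y
    simp only [hv, Nat.cast_add, he]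
  -- The identity of size `∏ i, q i` factors through `σ × Bool`, which is the source of the factor
  -- 2.
  have h3 := (Matrix.rank_mul_le_left U (W * E)).trans U.rank_le_card_width
  rw [h1, Matrix.rank_one] at h3
  simpa [Fintype.card_pi, ZMod.card, mul_comm] using h3

end Residues

/-! ### The automaton for the lower bound. -/

section CycleDFA

variable {ι : Type*} [LinearOrder ι] (q : ι → ℕ) (m : ℕ)

/-- The automaton that accepts the words `⊤ w` and the words `i ⊥ ^ k` with `q i ∣ k`; `m` of its
states are not reachable. -/
def cycleDFA : DFA (WithBot (WithTop ι)) ((Σ i, ZMod (q i)) ⊕ Fin 3 ⊕ Fin m) where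
  step
    | .inl ⟨i, x⟩, a => if a = ⊥ then .inl ⟨i, x + 1⟩ else .inr (.inl 1)
    | .inr (.inl 0), a => WithBot.recBotCoe (C := fun _ => (Σ i, ZMod (q i)) ⊕ Fin 3 ⊕ Fin m)
        (.inr (.inl 1)) (WithTop.recTopCoe (.inr (.inl 2)) fun i => .inl ⟨i, 0⟩) a
    | .inr s, _ => .inr s
  start := .inr (.inl 0)
  accept := {s | s = .inr (.inl 2) ∨ ∃ i, s = .inl ⟨i, 0⟩}

variable {q m}

theorem cycleDFA_evalFrom_one (w : List (WithBot (WithTop ι))) :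
    (cycleDFA q m).evalFrom (.inr (.inl 1)) w = .inr (.inl 1) := by
  induction w with
  | nil => rfl
  | cons a w ih => exact ih

theorem cycleDFA_evalFrom_two (w : List (WithBot (WithTop ι))) :
    (cycleDFA q m).evalFrom (.inr (.inl 2)) w = .inr (.inl 2) := by
  induction w with
  | nil => rfl
  | cons a w ih => exact ih

theorem cycleDFA_one_notMem_accept : .inr (.inl 1) ∉ (cycleDFA q m).accept := by
  rintro (h | ⟨i, h⟩) <;> simp at h

theorem cycleDFA_inl_mem_accept_iff {i : ι} {x : ZMod (q i)} :
    .inl ⟨i, x⟩ ∈ (cycleDFA q m).accept ↔ x = 0 := by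
  constructor
  · rintro (h | ⟨j, h⟩)
    · cases h
    · cases h
      rfl
  · rintro rfl
    exact Or.inr ⟨i, rfl⟩

theorem cycleDFA_mem_acceptsFrom_inl {i : ι} {x : ZMod (q i)} {w : List (WithBot (WithTop ι))} :
    (cycleDFA q m).evalFrom (.inl ⟨i, x⟩) w ∈ (cycleDFA q m).accept ↔
      w = List.replicate w.length ⊥ ∧ x + w.length = 0 := by
  induction w generalizing x with
  | nil => simp [cycleDFA_inl_mem_accept_iff]
  | cons a w ih =>
    have hs : (cycleDFA q m).step (.inl ⟨i, x⟩) a =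
      if a = ⊥ then .inl ⟨i, x + 1⟩ else .inr (.inl 1) := rfl
    rw [DFA.evalFrom_cons, hs]
    split_ifs with ha
    · subst ha
      rw [ih, List.length_cons, List.replicate_succ, List.cons.injEq, eq_self_iff_true, true_and,
        Nat.cast_succ, add_assoc, add_comm (1 : ZMod (q i))]
    · rw [cycleDFA_evalFrom_one]
      refine iff_of_false cycleDFA_one_notMem_accept fun h => ha ?_
      exact (List.cons.inj h.1).1

theorem cycleDFA_bot_cons_notMem (w : List (WithBot (WithTop ι))) :
    ⊥ :: w ∉ (cycleDFA q m).accepts := by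
  change ¬(cycleDFA q m).evalFrom (.inr (.inl 1)) w ∈ (cycleDFA q m).accept
  rw [cycleDFA_evalFrom_one]
  exact cycleDFA_one_notMem_accept

theorem cycleDFA_top_cons_mem (w : List (WithBot (WithTop ι))) :
    ((⊤ : WithTop ι) : WithBot (WithTop ι)) :: w ∈ (cycleDFA q m).accepts := by
  change (cycleDFA q m).evalFrom (.inr (.inl 2)) w ∈ (cycleDFA q m).accept
  rw [cycleDFA_evalFrom_two]
  exact Or.inl rfl

theorem cycleDFA_coe_cons_mem_iff {i : ι} {w : List (WithBot (WithTop ι))} :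
    ((i : WithTop ι) : WithBot (WithTop ι)) :: w ∈ (cycleDFA q m).accepts ↔
      w = List.replicate w.length ⊥ ∧ (w.length : ZMod (q i)) = 0 := by
  change (cycleDFA q m).evalFrom (.inl ⟨i, 0⟩) w ∈ (cycleDFA q m).accept ↔ _
  rw [cycleDFA_mem_acceptsFrom_inl, zero_add]

theorem List.not_lex_replicate_bot {α : Type*} [LinearOrder α] [OrderBot α] {k : ℕ} {w : List α}
    (hw : w.length = k) : ¬List.Lex (· < ·) w (List.replicate k ⊥) := by
  induction k generalizing w with
  | zero =>
    rw [List.length_eq_zero_iff.1 hw]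
    rintro ⟨⟩
  | succ k ih =>
    obtain _ | ⟨a, w⟩ := w
    · simp at hw
    · rw [List.replicate_succ, List.lex_cons_cons_iff']
      rintro (h | ⟨rfl, h⟩)
      · exact not_lt_bot h
      · exact ih (by simpa using hw) h

theorem cycleDFA_isSuccessor {c : WithTop ι} {k : ℕ}
    (hc : (c : WithBot (WithTop ι)) :: List.replicate k ⊥ ∈ (cycleDFA q m).accepts)
    (h : ∀ i : ι, (i : WithTop ι) < c → (k : ZMod (q i)) ≠ 0) :
    IsSuccessor (cycleDFA q m).accepts (List.replicate (k + 1) ⊥)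
      ((c : WithBot (WithTop ι)) :: List.replicate k ⊥) := by
  refine ⟨.of_lex (by simp) ?_, hc, fun w h1 h2 hw => ?_⟩
  · rw [List.replicate_succ]
    exact .rel (WithBot.bot_lt_coe c)
  · rw [List.shortlex_def] at h1 h2
    simp only [List.length_replicate, List.length_cons] at h1 h2
    have hlen : w.length = k + 1 := by omega
    have hlex := (h2.resolve_left (by omega)).2
    obtain _ | ⟨d, w⟩ := w
    · simp at hlen
    have hlen' : w.length = k := by simpa using hlen
    induction d using WithBot.recBotCoe with
    | bot => exact cycleDFA_bot_cons_notMem w hw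
    | coe d =>
      rw [List.lex_cons_cons_iff'] at hlex
      obtain hlt | ⟨-, hlex⟩ := hlex
      · rw [WithBot.coe_lt_coe] at hlt
        induction d using WithTop.recTopCoe with
        | top => exact not_top_lt hlt
        | coe i => exact h i hlt (hlen' ▸ (cycleDFA_coe_cons_mem_iff.1 hw).2)
      · exact List.not_lex_replicate_bot hlen' hlex

theorem exists_cycleDFA_isSuccessor [Finite ι] (k : ℕ) :
    ∃ v, IsSuccessor (cycleDFA q m).accepts (List.replicate (k + 1) ⊥) v ∧
      (v.head? = some ((⊤ : WithTop ι) : WithBot (WithTop ι)) ↔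
        ∀ i, (k : ZMod (q i)) ≠ 0) := by
  by_cases h : ∀ i, (k : ZMod (q i)) ≠ 0
  · exact ⟨_, cycleDFA_isSuccessor (cycleDFA_top_cons_mem _) fun i _ => h i, by simpa using h⟩
  · have h' := h
    push Not at h'
    obtain ⟨i, hi, hmin⟩ := wellFounded_lt.has_min {i | (k : ZMod (q i)) = 0} h'
    refine ⟨(i : WithTop ι) :: List.replicate k ⊥, cycleDFA_isSuccessor
      (cycleDFA_coe_cons_mem_iff.2 ⟨by simp, by simpa using hi⟩) fun j hj hk =>
        hmin j hk (WithTop.coe_lt_coe.1 hj), iff_of_false ?_ h⟩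
    simp

end CycleDFA

/-! ### Counting states and choosing the constants. -/

theorem log_le_sqrt_mul_log {n : ℕ} : Real.log n ≤ √((n : ℝ) * Real.log n) := by
  refine Real.le_sqrt_of_sq_le ?_
  rw [sq]
  refine mul_le_mul_of_nonneg_right ?_ (Real.log_natCast_nonneg n)
  rcases Nat.eq_zero_or_pos n with rfl | hn
  · simp
  · have : (0 : ℝ) < n := by exact_mod_cast hn
    linarith [Real.log_le_sub_one_of_pos this]

theorem sqrt_mul_log_le {n : ℕ} : √((n : ℝ) * Real.log n) ≤ n := by
  have hn0 : (0 : ℝ) ≤ n := Nat.cast_nonneg n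
  refine Real.sqrt_le_iff.2 ⟨hn0, ?_⟩
  rw [sq]
  refine mul_le_mul_of_nonneg_left ?_ hn0
  rcases Nat.eq_zero_or_pos n with rfl | hn
  · simp
  · have : (0 : ℝ) < n := by exact_mod_cast hn
    linarith [Real.log_le_sub_one_of_pos this]

/-- The successor transducer of an `n`-state automaton has at most `2 ^ (40 * √(n * log n))`
states. -/
theorem DFA.card_succState_le_two_rpow {α σ : Type*} [Fintype σ] (A : DFA α σ)
    (hσ : 2 ≤ Fintype.card σ) : (Nat.card A.SuccState : ℝ) ≤
      (2 : ℝ) ^ (40 * √((Fintype.card σ : ℝ) * Real.log (Fintype.card σ))) := by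
  obtain ⟨f, hf⟩ := A.ncard_range_live_le
  have hcard := A.card_succState_le.2
  have hord := log_orderOf_perm_le hσ f
  have hpos : 0 < orderOf f := orderOf_pos f
  rw [Nat.card_eq_fintype_card (α := σ)] at hcard
  set n := Fintype.card σ
  set P := orderOf f
  set z := √((n : ℝ) * Real.log n)
  have h1 : Nat.card A.SuccState ≤ n ^ 6 * P := by
    have h2 : n + P * (n + 1) ≤ 3 * n * P := by nlinarith
    calc Nat.card A.SuccState ≤ 1 + (n ^ 2 + 2 * n) * (Set.range A.live).ncard := hcard
      _ ≤ 1 + (2 * n ^ 2) * (3 * n * P) := by gcongr 1 + ?_ * ?_ <;> nlinarith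
      _ ≤ 8 * (n ^ 3 * P) := by
        have : 0 < n ^ 3 * P := by positivity
        nlinarith
      _ ≤ n ^ 3 * (n ^ 3 * P) := by
        gcongr
        exact Nat.pow_le_pow_left hσ 3
      _ = n ^ 6 * P := by ring
  have hn : (0 : ℝ) < n := by exact_mod_cast (by omega : 0 < n)
  have hP : (0 : ℝ) < P := by exact_mod_cast hpos
  calc (Nat.card A.SuccState : ℝ) ≤ (n : ℝ) ^ 6 * P := by exact_mod_cast h1
    _ = Real.exp (6 * Real.log n + Real.log P) := by
      rw [Real.exp_add, Real.exp_log hP, show (6 : ℝ) = (6 : ℕ) by norm_num, Real.exp_nat_mul,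
        Real.exp_log hn]
    _ ≤ Real.exp (Real.log 2 * (40 * z)) := by
      -- The constant 40 suffices because `6 + 20 ≤ 40 * log 2`.
      refine Real.exp_le_exp.2 ?_
      have h3 : Real.log n ≤ z := log_le_sqrt_mul_log
      have h4 := Real.log_two_gt_d9
      have h5 : 0 ≤ z := Real.sqrt_nonneg _
      nlinarith
    _ = (2 : ℝ) ^ (40 * z) := by rw [Real.rpow_def_of_pos (by norm_num)]

/-- Some `n`-state automaton needs successor transducers with at least two states. -/
theorem exists_dfa_two_le_card (n : ℕ) (hn : 2 ≤ n) :
    ∃ A : DFA Unit (Fin n), ∀ (τ : Type) [Fintype τ] (T : Transducer Unit Unit τ),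
      T.Unambiguous → (∀ u v, IsSuccessor A.accepts u v → T.Maps u v) → 2 ≤ Fintype.card τ := by
  -- All words over one letter are accepted, so the empty word has a nonempty successor.
  refine ⟨⟨fun s _ => s, ⟨0, by omega⟩, Set.univ⟩, fun τ _ T hT hmap =>
    hT.two_le_card (List.cons_ne_nil () []) (hmap [] [()] ⟨.of_length_lt (by simp),
      Set.mem_univ _, fun w h1 h2 _ => ?_⟩)⟩
  rw [List.shortlex_def] at h1 h2
  obtain h1 | ⟨-, h1⟩ := h1 <;> obtain h2 | ⟨-, h2⟩ := h2
  · simp only [List.length_nil, List.length_singleton] at h1 h2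
    omega
  · obtain _ | ⟨a, w⟩ := w
    · simp at h1
    · obtain h | ⟨-, h⟩ := List.lex_cons_cons_iff'.1 h2
      · exact lt_irrefl _ h
      · cases h
  · simp only [List.length_singleton, Nat.lt_one_iff, List.length_eq_zero_iff] at h2
    subst h2
    cases h1
  · cases h2 with
    | nil => cases h1
    | cons h => cases h
    | rel h => exact lt_irrefl _ h

/-- For large `n`, some `n`-state automaton needs successor transducers with at least
`exp (√(n * log n) / 60)` states. -/
theorem exists_dfa_le_log_card {n : ℕ} (hn : 160000 ≤ n) :
    ∃ (α : Type) (_ : Fintype α) (_ : LinearOrder α) (σ : Type) (_ : Fintype σ) (A : DFA α σ),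
      Fintype.card σ = n ∧ ∀ (τ : Type) [Fintype τ] (T : Transducer α α τ), T.Unambiguous →
        (∀ u v, IsSuccessor A.accepts u v → T.Maps u v) →
          √((n : ℝ) * Real.log n) / 60 ≤ Real.log (Fintype.card τ) := by
  obtain ⟨x, hx, hlog⟩ := exists_le_log_lcmUpto hn
  let ι := {p // p ∈ Nat.primesLE x}
  let q : ι → ℕ := fun p => p.1 ^ p.1.log x
  have hp : ∀ p : ι, p.1.Prime := fun p => Nat.prime_of_mem_primesLE p.2
  have hq2 : ∀ p : ι, 2 ≤ q p := fun p =>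
    (hp p).two_le.trans (Nat.le_self_pow
      (Nat.log_pos (hp p).one_lt (Nat.mem_primesLE.1 p.2).1).ne' _)
  have : ∀ p : ι, NeZero (q p) := fun p => ⟨by have := hq2 p; omega⟩
  have hcop : Pairwise (Function.onFun Nat.Coprime q) := fun a b hab =>
    Nat.Coprime.pow _ _ ((Nat.coprime_primes (hp a) (hp b)).2 fun h => hab (Subtype.ext h))
  have hsum : ∑ p : ι, q p = ∑ p ∈ Nat.primesLE x, p ^ p.log x :=
    Finset.sum_coe_sort (Nat.primesLE x) fun p => p ^ p.log x
  have hprod : ∏ p : ι, q p = Nat.lcmUpto x := by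
    rw [Nat.lcmUpto_eq_prod_pow_log]
    exact Finset.prod_coe_sort (Nat.primesLE x) fun p => p ^ p.log x
  refine ⟨WithBot (WithTop ι), inferInstance, inferInstance, _, inferInstance,
    cycleDFA q (n - (∑ p : ι, q p + 3)), ?_, fun τ _ T hT hmap => ?_⟩
  · simp only [Fintype.card_sum, Fintype.card_sigma, ZMod.card, Fintype.card_fin]
    omega
  · choose v hv hv' using exists_cycleDFA_isSuccessor (q := q) (m := n - (∑ p : ι, q p + 3))
    have hle := hT.prod_le_two_mul_card q hq2 hcop ⊥ _ v (fun k => hmap _ _ (hv k)) hv'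
    rw [hprod] at hle
    have hpos := Nat.lcmUpto_pos x
    have hcard : (0 : ℝ) < Fintype.card τ := by exact_mod_cast (by omega : 0 < Fintype.card τ)
    have h1 : Real.log (Nat.lcmUpto x) ≤ Real.log (2 * Fintype.card τ) :=
      Real.log_le_log (by exact_mod_cast hpos) (by exact_mod_cast hle)
    rw [Real.log_mul (by norm_num) hcard.ne'] at h1
    linarith

theorem mainTheorem8 :
    ∃ c C : ℝ, 0 < c ∧ 0 < C ∧ ∀ n : ℕ, 2 ≤ n →
      -- sufficient: every language of an `n`-state DFA
      (∀ (α : Type) [Fintype α] [LinearOrder α] (σ : Type) [Fintype σ] (A : DFA α σ),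
        Fintype.card σ = n →
        ∃ (τ : Type) (_ : Fintype τ) (T : Transducer α α τ),
          T.Unambiguous ∧
          (∀ u v : List α, T.Maps u v ↔ IsSuccessor A.accepts u v) ∧
          (Fintype.card τ : ℝ) ≤ (2 : ℝ) ^ (C * √((n : ℝ) * Real.log n))) ∧
      -- necessary: some language of an `n`-state DFA
      (∃ (α : Type) (_ : Fintype α) (_ : LinearOrder α) (σ : Type) (_ : Fintype σ) (A : DFA α σ),
        Fintype.card σ = n ∧
        ∀ (τ : Type) [Fintype τ] (T : Transducer α α τ),
          T.Unambiguous →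
          (∀ u v : List α, IsSuccessor A.accepts u v → T.Maps u v) →
          (2 : ℝ) ^ (c * √((n : ℝ) * Real.log n)) ≤ (Fintype.card τ : ℝ)) := by
  -- For `n < 160000` this `c` makes the exponent at most 1, so two states suffice as a lower bound;
  -- for larger `n` it is well below `1 / (60 * log 2)`.
  refine ⟨1 / 160000, 40, by norm_num, by norm_num, fun n hn => ⟨?_, ?_⟩⟩
  · rintro α _ _ σ _ A rfl
    have := A.card_succState_le.1
    have := Fintype.ofFinite A.SuccState
    refine ⟨A.SuccState, this, A.succTransducer, DFA.succTransducer_unambiguous,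
      fun u v => DFA.succTransducer_maps_iff, ?_⟩
    rw [← Nat.card_eq_fintype_card (α := A.SuccState)]
    exact A.card_succState_le_two_rpow hn
  · rcases lt_or_ge n 160000 with hlt | hge
    · obtain ⟨A, hA⟩ := exists_dfa_two_le_card n hn
      refine ⟨Unit, inferInstance, inferInstance, Fin n, inferInstance, A, Fintype.card_fin n,
        fun τ _ T hT hmap => ?_⟩
      have h1 : (n : ℝ) ≤ 160000 := by exact_mod_cast hlt.le
      have h2 := sqrt_mul_log_le (n := n)
      calc (2 : ℝ) ^ (1 / 160000 * √((n : ℝ) * Real.log n)) ≤ (2 : ℝ) ^ (1 : ℝ) :=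
            Real.rpow_le_rpow_of_exponent_le (by norm_num) (by linarith)
        _ = (2 : ℕ) := by norm_num
        _ ≤ Fintype.card τ := Nat.cast_le.2 (hA τ T hT hmap)
    · obtain ⟨α, hα, hα', σ, hσ, A, hcard, hA⟩ := exists_dfa_le_log_card hge
      refine ⟨α, hα, hα', σ, hσ, A, hcard, fun τ _ T hT hmap => ?_⟩
      have h1 := hA τ T hT hmap
      have hz : 0 < √((n : ℝ) * Real.log n) :=
        (Real.log_pos (by exact_mod_cast hn)).trans_le log_le_sqrt_mul_log
      have hpos : (0 : ℝ) < Fintype.card τ := by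
        refine (Nat.cast_nonneg _).lt_of_ne' fun h0 => ?_
        rw [h0, Real.log_zero] at h1
        linarith
      rw [Real.rpow_def_of_pos (by norm_num), ← Real.le_log_iff_exp_le hpos]
      refine le_trans ?_ h1
      have := Real.log_two_lt_d9
      nlinarith
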